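/- **Setting.** Let $\mathcal A$ be a finite-dimensional $C^*$-algebra, realized as a unital $*$-subalgebra of $\mathbb M_{d_{\mathcal A}}(\mathbb C)$; write $\mathcal A^{\otimes n}\subseteq \mathbb M_{d_{\mathcal A}}^{\otimes n}$. Let $\omega$ be a translation invariant state on the chain $\mathcal A^{\otimes\mathbb Z}$, with marginals $\omega_n$ on $n$ consecutive sites. A *realization* of $\omega$ is $(V,e,\mathbb E,\rho)$ with $V$ a finite-dimensional complex vector space, $e\in V$, $\rho\in V^*$ and $\mathbb E:\mathcal A\to\mathrm{End}(V)$ linear, such that $\omega(A_1\otimes\cdots\otimes A_n)=\rho\,\mathbb E_{A_1}\cdots\mathbb E_{A_n}e$, $\rho\,\mathbb E_{1}=\rho$ and $\mathbb E_{1}e=e$. Assume that $\omega$ has a realization (it is *finitely correlated*) and let $m$ be the minimal dimension of $V$. A *$C^*$-realization* is a realization in which $V=\mathcal B$ is a finite-dimensional $C^*$-algebra, realized as a unital $*$-subalgebra of $\mathbb M_{d_{\mathcal B}}(\mathbb C)$, $e=1_{\mathcal B}$, $\rho$ is a state of $\mathcal B$, and $A\otimes B\mapsto\mathbb E_A(B)$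 is a unital completely positive map $\mathcal A\otimes\mathcal B\to\mathcal B$. Let $\mathcal C_L\subseteq\mathcal A^{\otimes l}$ and $\mathcal C_R\subseteq \mathcal A^{\otimes r}$ be unital $*$-subalgebras, placed on the $l$ sites to the left and the $r$ sites to the right of a cut, and define $\Omega:\mathcal C_R\to\mathcal C_L^*$ and $\Omega_A:\mathcal C_R\to\mathcal C_L^*$ ($A\in\mathcal A$) by $$\Omega(X)[Y]=\omega(Y\otimes X),\qquad \Omega_A(X)[Y]=\omega(Y\otimes A\otimes X).$$ Assume that $\Omega$ has rank $m$. Let $\tau:\mathcal C_L^*\to\mathbb C$ be evaluation at $1$. Fix bases $\{X_j\}$ of $\mathcal C_R$, $\{Y_i\}$ of $\mathcal C_L$ and $\{Z_k\}$ of $\mathcal A$ consisting of self-adjoint elements and orthonormal for the trace, $\operatorname{Tr}[X_iX_j]=\delta_{ij}$ etc., and identify $\Omega$ with the matrix $(\Omega(X_j)[Y_i])_{ij}$, similarly for $\Omega_A$, for $\Omega(1)\in\mathcal C_L^*$ and for $\tau\Omega\in\mathcal C_R^*$. Let $\sigma_m(\Omega)$ be the $m$-th largest singular value and $\|\cdot\|_2$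 the Hilbert–Schmidt (Euclidean) norm; in particular $\|\Omega_{(\cdot)}\|_2^2=\sum_{i,j,k}|\Omega_{Z_k}(X_j)[Y_i]|^2$. **Reconstruction.** Let $\widehat{\tau\Omega}$, $\widehat{\Omega(1)}$, $\hat\Omega$ and $\hat\Omega_{(\cdot)}$ (linear in $A\in\mathcal A$) be arbitrary vectors and matrices with real or complex entries, of the same sizes as $\tau\Omega$, $\Omega(1)$, $\Omega$ and $\Omega_{(\cdot)}$, where $\hat\Omega$ has rank at least $m$. Let $\hat U$ be the matrix of the first $m$ left singular vectors in a singular value decomposition of $\hat\Omega$ (singular values in decreasing order). With $\dagger$ the adjoint (the transpose for real matrices) and $+$ the Moore–Penrose pseudoinverse, put $$\hat e=\hat U^\dagger\,\widehat{\Omega(1)},\qquad \hat\rho=\widehat{\tau\Omega}\,(\hat U^\dagger\hat\Omega)^+,\qquad \hat{\mathbb K}_A=\hat U^\dagger\hat\Omega_A(\hat U^\dagger\hat\Omega)^+,$$ and, for $t\ge 1$, let $\hat\omega_t$ be the linear functional on $\mathcal A^{\otimes t}$ with $\hat\omega_t(A_1\otimes\cdots\otimes A_t)=\hat\rho\,\hat{\mathbb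 K}_{A_1}\cdots\hat{\mathbb K}_{A_t}\hat e$. For a functional $\varphi$ on $\mathcal A^{\otimes t}$ let $\|\varphi\|_1=\sup\{|\varphi(X)|:\ X\in\mathcal A^{\otimes t},\ \|X\|_\infty\le1\}$, with $\|\cdot\|_\infty$ the operator norm. **Theorem.** Let $\epsilon<1$ and $t\geq 1$. (i) If $$\|\tau\Omega-\widehat{\tau\Omega}\|_2\le\tfrac{3\sigma_m(\Omega)}{4}\epsilon,\qquad \|\Omega(1)-\widehat{\Omega(1)}\|_2\le\tfrac{\sqrt3\,\sigma_m(\Omega)}{2}\epsilon,$$ $$\|\Omega-\hat\Omega\|_2\le\tfrac13\min\Big(\tfrac{\sigma_m(\Omega)^2}{4}\epsilon,\ \tfrac{\sqrt3\,\sigma_m(\Omega)^3}{8tm\sqrt{d_{\mathcal A}}}\epsilon\Big),\qquad \|\Omega_{(\cdot)}-\hat\Omega_{(\cdot)}\|_2\le\tfrac{3\sqrt3\,\sigma_m(\Omega)^2}{8tm\sqrt{d_{\mathcal A}}}\epsilon,$$ then $\|\hat\omega_t-\omega_t\|_1\le\frac{145}{9}\epsilon$. (ii) If $\omega$ has a $C^*$-realization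 with memory $\mathcal B\subseteq\mathbb M_{d_{\mathcal B}}$ and $$\|\tau\Omega-\widehat{\tau\Omega}\|_2\le\tfrac{3\sigma_m(\Omega)}{4}\epsilon,\qquad \|\Omega(1)-\widehat{\Omega(1)}\|_2\le\tfrac{\sqrt3\,\sigma_m(\Omega)}{2\sqrt{d_{\mathcal B}}}\epsilon,$$ $$\|\Omega-\hat\Omega\|_2\le\tfrac13\min\Big(\tfrac{\sigma_m(\Omega)^2}{4}\epsilon,\ \tfrac{\sqrt3\,\sigma_m(\Omega)^3}{8t\,d_{\mathcal B}\sqrt{d_{\mathcal A}}}\epsilon\Big),\qquad \|\Omega_{(\cdot)}-\hat\Omega_{(\cdot)}\|_2\le\tfrac{3\sqrt3\,\sigma_m(\Omega)^2}{8t\,d_{\mathcal B}\sqrt{d_{\mathcal A}}}\epsilon,$$ then $\|\hat\omega_t-\omega_t\|_1\le\frac{145}{9}\epsilon$. -/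

import Mathlib

open scoped Matrix Kronecker ComplexOrder
open Matrix

noncomputable section

namespace FCS

/-! ### Local algebras of the chain -/

/-- The elementary tensor `A₁ ⊗ ⋯ ⊗ Aₙ`, as a matrix indexed by configurations `Fin n → Fin d`. -/
def elem {d n : ℕ} (A : Fin n → Matrix (Fin d) (Fin d) ℂ) :
    Matrix (Fin n → Fin d) (Fin n → Fin d) ℂ :=
  Matrix.of fun f g => ∏ i, A i (f i) (g i)

/-- The tensor product `Y ⊗ X` of an observable on `a` sites with one on the next `b` sites. -/
def tens {d a b : ℕ} (Y : Matrix (Fin a → Fin d) (Fin a → Fin d) ℂ)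
    (X : Matrix (Fin b → Fin d) (Fin b → Fin d) ℂ) :
    Matrix (Fin (a + b) → Fin d) (Fin (a + b) → Fin d) ℂ :=
  Matrix.of fun f g =>
    Y (fun i => f (Fin.castAdd b i)) (fun i => g (Fin.castAdd b i)) *
      X (fun i => f (Fin.natAdd a i)) (fun i => g (Fin.natAdd a i))

/-- The algebra `𝒜^{⊗ n}` of `n` consecutive sites, for a one-site algebra
`𝒜 ⊆ M_d(ℂ)`, realized inside `M_d(ℂ)^{⊗ n}`. -/
def chainAlg {d : ℕ} (𝒜 : StarSubalgebra ℂ (Matrix (Fin d) (Fin d) ℂ)) (n : ℕ) :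
    StarSubalgebra ℂ (Matrix (Fin n → Fin d) (Fin n → Fin d) ℂ) :=
  StarAlgebra.adjoin ℂ {M | ∃ A : Fin n → 𝒜, M = elem fun i => (A i : Matrix (Fin d) (Fin d) ℂ)}

section TensLemmas

variable {d a b : ℕ}

theorem tens_add_left (Y Y' : Matrix (Fin a → Fin d) (Fin a → Fin d) ℂ)
    (X : Matrix (Fin b → Fin d) (Fin b → Fin d) ℂ) :
    tens (Y + Y') X = tens Y X + tens Y' X := by
  ext f g; simp [tens, add_mul]

theorem tens_add_right (Y : Matrix (Fin a → Fin d) (Fin a → Fin d) ℂ)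
    (X X' : Matrix (Fin b → Fin d) (Fin b → Fin d) ℂ) :
    tens Y (X + X') = tens Y X + tens Y X' := by
  ext f g; simp [tens, mul_add]

theorem tens_smul_left (c : ℂ) (Y : Matrix (Fin a → Fin d) (Fin a → Fin d) ℂ)
    (X : Matrix (Fin b → Fin d) (Fin b → Fin d) ℂ) :
    tens (c • Y) X = c • tens Y X := by
  ext f g; simp [tens, mul_assoc]

theorem tens_smul_right (c : ℂ) (Y : Matrix (Fin a → Fin d) (Fin a → Fin d) ℂ)
    (X : Matrix (Fin b → Fin d) (Fin b → Fin d) ℂ) :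
    tens Y (c • X) = c • tens Y X := by
  ext f g; simp [tens, mul_left_comm]

theorem tens_star (Y : Matrix (Fin a → Fin d) (Fin a → Fin d) ℂ)
    (X : Matrix (Fin b → Fin d) (Fin b → Fin d) ℂ) :
    tens (star Y) (star X) = star (tens Y X) := by
  ext f g; simp [tens, Matrix.star_apply]

theorem tens_mul (Y Y' : Matrix (Fin a → Fin d) (Fin a → Fin d) ℂ)
    (X X' : Matrix (Fin b → Fin d) (Fin b → Fin d) ℂ) :
    tens (Y * Y') (X * X') = tens Y X * tens Y' X' := by
  ext f g
  simp only [tens, Matrix.of_apply, Matrix.mul_apply]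
  rw [← (Fin.appendEquiv a b).sum_comp, Fintype.sum_prod_type, Finset.sum_mul_sum]
  refine Finset.sum_congr rfl fun u _ => Finset.sum_congr rfl fun v _ => ?_
  simp [Fin.appendEquiv]
  ring

theorem tens_elem (A : Fin a → Matrix (Fin d) (Fin d) ℂ) (B : Fin b → Matrix (Fin d) (Fin d) ℂ) :
    tens (elem A) (elem B) = elem (Fin.append A B) := by
  ext f g
  simp [tens, elem, Fin.prod_univ_add]

theorem elem_one (n : ℕ) : elem (fun _ : Fin n => (1 : Matrix (Fin d) (Fin d) ℂ)) = 1 := by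
  ext f g
  simp only [elem, Matrix.of_apply, Matrix.one_apply]
  by_cases h : f = g
  · simp [h]
  · rw [if_neg h]
    obtain ⟨i, hi⟩ := Function.ne_iff.mp h
    exact Finset.prod_eq_zero (Finset.mem_univ i) (by simp [hi])

theorem elem_mem {𝒜 : StarSubalgebra ℂ (Matrix (Fin d) (Fin d) ℂ)} {n : ℕ} (A : Fin n → 𝒜) :
    elem (fun i => (A i : Matrix (Fin d) (Fin d) ℂ)) ∈ chainAlg 𝒜 n :=
  StarAlgebra.subset_adjoin _ _ ⟨A, rfl⟩

theorem tens_mem {𝒜 : StarSubalgebra ℂ (Matrix (Fin d) (Fin d) ℂ)}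
    {Y : Matrix (Fin a → Fin d) (Fin a → Fin d) ℂ} (hY : Y ∈ chainAlg 𝒜 a)
    {X : Matrix (Fin b → Fin d) (Fin b → Fin d) ℂ} (hX : X ∈ chainAlg 𝒜 b) :
    tens Y X ∈ chainAlg 𝒜 (a + b) := by
  have base : ∀ (A : Fin a → 𝒜) (B : Fin b → 𝒜),
      tens (elem fun i => (A i : Matrix (Fin d) (Fin d) ℂ))
        (elem fun i => (B i : Matrix (Fin d) (Fin d) ℂ)) ∈ chainAlg 𝒜 (a + b) := by
    intro A B
    rw [tens_elem]
    refine StarAlgebra.subset_adjoin _ _ ⟨Fin.append A B, ?_⟩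
    congr 1
    funext i
    refine Fin.addCases (fun j => ?_) (fun j => ?_) i <;> simp
  have oneA : elem (fun _ : Fin a => ((1 : 𝒜) : Matrix (Fin d) (Fin d) ℂ)) = 1 := elem_one a
  have oneB : elem (fun _ : Fin b => ((1 : 𝒜) : Matrix (Fin d) (Fin d) ℂ)) = 1 := elem_one b
  have left : ∀ Y ∈ chainAlg 𝒜 a, tens Y (1 : Matrix (Fin b → Fin d) (Fin b → Fin d) ℂ)
      ∈ chainAlg 𝒜 (a + b) := by
    intro Y hY
    induction hY using StarAlgebra.adjoin_induction with
    | mem x hx => obtain ⟨A, rfl⟩ := hx; rw [← oneB]; exact base A fun _ => 1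
    | algebraMap c =>
      rw [Algebra.algebraMap_eq_smul_one, tens_smul_left, ← oneA, ← oneB]
      exact SMulMemClass.smul_mem c (base (fun _ => 1) fun _ => 1)
    | add x y _ _ hx hy => rw [tens_add_left]; exact add_mem hx hy
    | mul x y _ _ hx hy => rw [← mul_one 1, tens_mul]; exact mul_mem hx hy
    | star x _ hx => rw [← star_one, tens_star]; exact star_mem hx
  have right : ∀ X ∈ chainAlg 𝒜 b, tens (1 : Matrix (Fin a → Fin d) (Fin a → Fin d) ℂ) X
      ∈ chainAlg 𝒜 (a + b) := by
    intro X hX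
    induction hX using StarAlgebra.adjoin_induction with
    | mem x hx => obtain ⟨A, rfl⟩ := hx; rw [← oneA]; exact base (fun _ => 1) A
    | algebraMap c =>
      rw [Algebra.algebraMap_eq_smul_one, tens_smul_right, ← oneA, ← oneB]
      exact SMulMemClass.smul_mem c (base (fun _ => 1) fun _ => 1)
    | add x y _ _ hx hy => rw [tens_add_right]; exact add_mem hx hy
    | mul x y _ _ hx hy => rw [← mul_one 1, tens_mul]; exact mul_mem hx hy
    | star x _ hx => rw [← star_one, tens_star]; exact star_mem hx
  have h := mul_mem (left Y hY) (right X hX)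
  rwa [← tens_mul, mul_one, one_mul] at h

end TensLemmas

/-! ### States and realizations -/

/-- A translation invariant state on the infinite chain with one-site algebra `𝒜`, given by its
marginals `ω n` on `n` consecutive sites: positive unital functionals on `𝒜^{⊗ n}` that are
compatible with adding a site on the right and on the left. -/
structure ChainState {d : ℕ} (𝒜 : StarSubalgebra ℂ (Matrix (Fin d) (Fin d) ℂ)) where
  marginal : ∀ n, chainAlg 𝒜 n →ₗ[ℂ] ℂ
  nonneg : ∀ n (X : chainAlg 𝒜 n), 0 ≤ marginal n (star X * X)
  map_one : ∀ n, marginal n 1 = 1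
  right : ∀ n (X : chainAlg 𝒜 n),
    marginal (n + 1) ⟨tens X.1 1, tens_mem X.2 (one_mem (chainAlg 𝒜 1))⟩ = marginal n X
  left : ∀ n (X : chainAlg 𝒜 n),
    marginal (1 + n) ⟨tens 1 X.1, tens_mem (one_mem (chainAlg 𝒜 1)) X.2⟩ = marginal n X

/-- A (linear) realization `(V, e, 𝔼, ρ)` of a translation invariant state:
`ω(A₁ ⊗ ⋯ ⊗ Aₙ) = ρ 𝔼_{A₁} ⋯ 𝔼_{Aₙ} e`, `ρ 𝔼_1 = ρ`, `𝔼_1 e = e`. -/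
structure Realization {d : ℕ} {𝒜 : StarSubalgebra ℂ (Matrix (Fin d) (Fin d) ℂ)}
    (ω : ChainState 𝒜) (V : Type*) [AddCommGroup V] [Module ℂ V] where
  e : V
  E : 𝒜 →ₗ[ℂ] Module.End ℂ V
  ρ : V →ₗ[ℂ] ℂ
  generates : ∀ n (A : Fin n → 𝒜),
    ω.marginal n ⟨elem fun i => (A i : Matrix (Fin d) (Fin d) ℂ), elem_mem A⟩ =
      ρ ((List.ofFn fun i => E (A i)).prod e)
  ρ_E_one : ρ ∘ₗ E 1 = ρ
  E_one_e : E 1 e = e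

/-- `ω` is finitely correlated, and `m` is the minimal dimension of a realization of `ω`. -/
def IsMinimalDim {d : ℕ} {𝒜 : StarSubalgebra ℂ (Matrix (Fin d) (Fin d) ℂ)}
    (ω : ChainState 𝒜) (m : ℕ) : Prop :=
  IsLeast {n : ℕ | Nonempty (Realization ω (Fin n → ℂ))} m

/-- Complete positivity of a linear map between unital `*`-algebras of matrices: all
amplifications `M_n(S) → M_n(T)` preserve positive semidefinite matrices. -/
def IsCompletelyPositive {M N : Type*} [Fintype M] [DecidableEq M] [Fintype N] [DecidableEq N]
    {S : StarSubalgebra ℂ (Matrix M M ℂ)} {T : StarSubalgebra ℂ (Matrix N N ℂ)}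
    (f : S →ₗ[ℂ] T) : Prop :=
  ∀ (n : ℕ) (X : Matrix (Fin n) (Fin n) S),
    (Matrix.comp _ _ _ _ ℂ (X.map fun x => (x : Matrix M M ℂ))).PosSemidef →
      (Matrix.comp _ _ _ _ ℂ (X.map fun x => (f x : Matrix N N ℂ))).PosSemidef

/-- The tensor product `𝒜 ⊗ ℬ` of two matrix `*`-algebras, inside `M_{d × d'}(ℂ)`. -/
def tensorAlg {d d' : ℕ} (𝒜 : StarSubalgebra ℂ (Matrix (Fin d) (Fin d) ℂ))
    (ℬ : StarSubalgebra ℂ (Matrix (Fin d') (Fin d') ℂ)) :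
    StarSubalgebra ℂ (Matrix (Fin d × Fin d') (Fin d × Fin d') ℂ) :=
  StarAlgebra.adjoin ℂ {M | ∃ (A : 𝒜) (B : ℬ),
    M = (A : Matrix (Fin d) (Fin d) ℂ) ⊗ₖ (B : Matrix (Fin d') (Fin d') ℂ)}

theorem kronecker_mem {d d' : ℕ} {𝒜 : StarSubalgebra ℂ (Matrix (Fin d) (Fin d) ℂ)}
    {ℬ : StarSubalgebra ℂ (Matrix (Fin d') (Fin d') ℂ)} (A : 𝒜) (B : ℬ) :
    (A : Matrix (Fin d) (Fin d) ℂ) ⊗ₖ (B : Matrix (Fin d') (Fin d') ℂ) ∈ tensorAlg 𝒜 ℬ :=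
  StarAlgebra.subset_adjoin _ _ ⟨A, B, rfl⟩

/-- A realization whose memory is a finite-dimensional `C*`-algebra `ℬ` is a `C*`-realization if
`e = 1`, the functional is a state of `ℬ`, and `A ⊗ B ↦ 𝔼_A(B)` is a unital completely positive map
`𝒜 ⊗ ℬ → ℬ`. -/
structure IsCStarRealization {d d' : ℕ} {𝒜 : StarSubalgebra ℂ (Matrix (Fin d) (Fin d) ℂ)}
    {ω : ChainState 𝒜} {ℬ : StarSubalgebra ℂ (Matrix (Fin d') (Fin d') ℂ)}
    (R : Realization ω ℬ) : Prop where
  e_eq_one : R.e = 1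
  ρ_nonneg : ∀ B : ℬ, 0 ≤ R.ρ (star B * B)
  ρ_one : R.ρ 1 = 1
  exists_cp : ∃ Φ : tensorAlg 𝒜 ℬ →ₗ[ℂ] ℬ, IsCompletelyPositive Φ ∧ Φ 1 = 1 ∧
    ∀ (A : 𝒜) (B : ℬ), Φ ⟨_, kronecker_mem A B⟩ = R.E A B

/-! ### The maps `Ω` and `Ω_(·)` -/

section Hankel

variable {d l r : ℕ} {𝒜 : StarSubalgebra ℂ (Matrix (Fin d) (Fin d) ℂ)} (ω : ChainState 𝒜)
  {CL : StarSubalgebra ℂ (Matrix (Fin l → Fin d) (Fin l → Fin d) ℂ)}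
  {CR : StarSubalgebra ℂ (Matrix (Fin r → Fin d) (Fin r → Fin d) ℂ)}
  (hCL : CL ≤ chainAlg 𝒜 l) (hCR : CR ≤ chainAlg 𝒜 r)

/-- `Ω : 𝒞_R → 𝒞_L^*`, `Ω(X)[Y] = ω(Y ⊗ X)`. -/
def hankel : CR →ₗ[ℂ] Module.Dual ℂ CL :=
  LinearMap.mk₂ ℂ (fun (X : CR) (Y : CL) =>
      ω.marginal (l + r) ⟨tens Y.1 X.1, tens_mem (hCL Y.2) (hCR X.2)⟩)
    (fun X X' Y => by
      rw [← map_add]; congr 1; exact Subtype.ext (tens_add_right _ _ _))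
    (fun c X Y => by
      rw [← map_smul]; congr 1; exact Subtype.ext (tens_smul_right _ _ _))
    (fun X Y Y' => by
      rw [← map_add]; congr 1; exact Subtype.ext (tens_add_left _ _ _))
    (fun c X Y => by
      rw [← map_smul]; congr 1; exact Subtype.ext (tens_smul_left _ _ _))

theorem site_mem (A : 𝒜) :
    elem (fun _ : Fin 1 => (A : Matrix (Fin d) (Fin d) ℂ)) ∈ chainAlg 𝒜 1 :=
  elem_mem fun _ : Fin 1 => A

/-- The number `Ω_A(X)[Y] = ω(Y ⊗ A ⊗ X)`. -/
def hankelSite (A : 𝒜) (X : CR) (Y : CL) : ℂ :=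
  ω.marginal (l + 1 + r) ⟨tens (tens Y.1 (elem fun _ : Fin 1 => (A : Matrix (Fin d) (Fin d) ℂ))) X.1,
    tens_mem (tens_mem (hCL Y.2) (site_mem A)) (hCR X.2)⟩

end Hankel

/-- A basis of a matrix `*`-algebra consisting of self-adjoint elements with
`Tr[X_i X_j] = δ_{ij}`. -/
structure HSBasis {N : Type*} [Fintype N] [DecidableEq N] (S : StarSubalgebra ℂ (Matrix N N ℂ))
    (k : ℕ) where
  basis : Module.Basis (Fin k) ℂ S
  isHermitian : ∀ i, (basis i : Matrix N N ℂ).IsHermitian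
  trace_mul : ∀ i j, ((basis i : Matrix N N ℂ) * (basis j : Matrix N N ℂ)).trace =
    if i = j then 1 else 0

section HankelMatrix

variable {d l r p q : ℕ} {𝒜 : StarSubalgebra ℂ (Matrix (Fin d) (Fin d) ℂ)} (ω : ChainState 𝒜)
  {CL : StarSubalgebra ℂ (Matrix (Fin l → Fin d) (Fin l → Fin d) ℂ)}
  {CR : StarSubalgebra ℂ (Matrix (Fin r → Fin d) (Fin r → Fin d) ℂ)}
  (hCL : CL ≤ chainAlg 𝒜 l) (hCR : CR ≤ chainAlg 𝒜 r) (Y : HSBasis CL p) (X : HSBasis CR q)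

/-- The coordinate matrix `Ω(X_j)[Y_i]` of `Ω`. -/
def hankelMatrix : Matrix (Fin p) (Fin q) ℂ :=
  Matrix.of fun i j => hankel ω hCL hCR (X.basis j) (Y.basis i)

/-- The coordinate matrix `Ω_A(X_j)[Y_i]` of `Ω_A`. -/
def hankelSiteMatrix (A : 𝒜) : Matrix (Fin p) (Fin q) ℂ :=
  Matrix.of fun i j => hankelSite ω hCL hCR A (X.basis j) (Y.basis i)

/-- The coordinates `Ω(1)[Y_i]` of the functional `Ω(1)` on `𝒞_L`. -/
def hankelOne : Fin p → ℂ := fun i => hankel ω hCL hCR 1 (Y.basis i)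

/-- The coordinates `Ω(X_j)[1]` of the functional `τΩ` on `𝒞_R`, where `τ` is evaluation at `1`. -/
def tauHankel : Fin q → ℂ := fun j => hankel ω hCL hCR (X.basis j) 1

end HankelMatrix

/-! ### Norms, singular values, pseudoinverses -/

/-- The Hilbert–Schmidt (Frobenius) norm of a matrix. -/
def hsNorm {p q : ℕ} (M : Matrix (Fin p) (Fin q) ℂ) : ℝ :=
  Real.sqrt (∑ i, ∑ j, ‖M i j‖ ^ 2)

/-- The Hilbert–Schmidt norm of the linear map `A ⊗ X ↦ F_A(X)` on `𝒜 ⊗ 𝒞_R`, where `F A` is the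
coordinate matrix of `F_A` and `Z` is an orthonormal basis of `𝒜`. -/
def hsNormSite {d k p q : ℕ} {𝒜 : StarSubalgebra ℂ (Matrix (Fin d) (Fin d) ℂ)} (Z : HSBasis 𝒜 k)
    (F : 𝒜 → Matrix (Fin p) (Fin q) ℂ) : ℝ :=
  Real.sqrt (∑ i, hsNorm (F (Z.basis i)) ^ 2)

/-- The Euclidean norm of a coordinate vector. -/
def euclNorm {p : ℕ} (v : Fin p → ℂ) : ℝ :=
  Real.sqrt (∑ i, ‖v i‖ ^ 2)

/-- The `m`-th largest singular value `σ_m(M)` (counted from `σ_1`). -/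
def sigma {p q : ℕ} (m : ℕ) (M : Matrix (Fin p) (Fin q) ℂ) : ℝ :=
  (Matrix.toEuclideanLin M).singularValues (m - 1)

/-- `U` consists of the first `m` left singular vectors in a singular value decomposition
`M = W diag(s₁ ≥ s₂ ≥ ⋯ > 0) O` of `M`; in particular `M` has rank at least `m`. -/
def IsTruncatedLeftSVD {p q m : ℕ} (M : Matrix (Fin p) (Fin q) ℂ)
    (U : Matrix (Fin p) (Fin m) ℂ) : Prop :=
  ∃ (k : ℕ) (hk : m ≤ k) (W : Matrix (Fin p) (Fin k) ℂ) (O : Matrix (Fin k) (Fin q) ℂ)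
    (s : Fin k → ℝ), Wᴴ * W = 1 ∧ O * Oᴴ = 1 ∧ Antitone s ∧ (∀ i, 0 < s i) ∧
      M = W * Matrix.diagonal (fun i => (s i : ℂ)) * O ∧ U = W.submatrix id (Fin.castLE hk)

/-- The four Penrose conditions characterizing the Moore–Penrose pseudoinverse. -/
structure IsMoorePenrose {p q : ℕ} (M : Matrix (Fin p) (Fin q) ℂ)
    (P : Matrix (Fin q) (Fin p) ℂ) : Prop where
  mul_mul_self : M * P * M = M
  self_mul_mul : P * M * P = P
  isHermitian_left : (M * P).IsHermitian
  isHermitian_right : (P * M).IsHermitian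

/-- The Moore–Penrose pseudoinverse `M⁺ = (Mᴴ M)⁺ Mᴴ`, where the pseudoinverse of the positive
matrix `Mᴴ M` inverts its nonzero eigenvalues. -/
def pinv {p q : ℕ} (M : Matrix (Fin p) (Fin q) ℂ) : Matrix (Fin q) (Fin p) ℂ :=
  (Matrix.isHermitian_conjTranspose_mul_self M).cfc (fun x => x⁻¹) * Mᴴ

theorem isMoorePenrose_pinv {p q : ℕ} (M : Matrix (Fin p) (Fin q) ℂ) :
    IsMoorePenrose M (pinv M) := by
  have hH := Matrix.isHermitian_conjTranspose_mul_self M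
  obtain ⟨G, hP, φ, v, hHs, hGs⟩ : ∃ G : Matrix (Fin q) (Fin q) ℂ, pinv M = G * Mᴴ ∧
      ∃ (φ : Matrix (Fin q) (Fin q) ℂ ≃⋆ₐ[ℂ] Matrix (Fin q) (Fin q) ℂ) (v : Fin q → ℝ),
        Mᴴ * M = φ (Matrix.diagonal (RCLike.ofReal ∘ v)) ∧
          G = φ (Matrix.diagonal (RCLike.ofReal ∘ (fun x => x⁻¹) ∘ v)) :=
    ⟨_, rfl, _, _, hH.spectral_theorem, rfl⟩
  have hGH : (G * (Mᴴ * M))ᴴ = G * (Mᴴ * M) := by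
    rw [hGs, hHs, ← map_mul, ← Matrix.star_eq_conjTranspose, ← map_star,
      Matrix.diagonal_mul_diagonal, Matrix.star_eq_conjTranspose, Matrix.diagonal_conjTranspose]
    congr 2
    funext i
    simp
  have hGherm : Gᴴ = G := by
    rw [hGs, ← Matrix.star_eq_conjTranspose, ← map_star, Matrix.star_eq_conjTranspose,
      Matrix.diagonal_conjTranspose]
    congr 2
    funext i
    simp
  have hHGH : Mᴴ * M * G * (Mᴴ * M) = Mᴴ * M := by
    conv_rhs => rw [hHs]
    rw [hGs, hHs, ← map_mul, ← map_mul, Matrix.diagonal_mul_diagonal,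
      Matrix.diagonal_mul_diagonal]
    congr 2
    funext i
    by_cases h : v i = 0 <;> simp [h]
  have hGHG : G * (Mᴴ * M) * G = G := by
    conv_rhs => rw [hGs]
    rw [hGs, hHs, ← map_mul, ← map_mul, Matrix.diagonal_mul_diagonal,
      Matrix.diagonal_mul_diagonal]
    congr 2
    funext i
    by_cases h : v i = 0 <;> simp [h]
  have hMGH : M * (G * (Mᴴ * M)) = M := by
    rw [← sub_eq_zero, ← Matrix.conjTranspose_mul_self_eq_zero, Matrix.conjTranspose_sub,
      Matrix.conjTranspose_mul, hGH]
    have e1 : (G * (Mᴴ * M) * Mᴴ - Mᴴ) * (M * (G * (Mᴴ * M)) - M) =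
        G * (Mᴴ * M * (Mᴴ * M) * G * (Mᴴ * M)) - G * (Mᴴ * M * (Mᴴ * M))
          - (Mᴴ * M * G * (Mᴴ * M) - Mᴴ * M) := by
      simp only [Matrix.mul_assoc, Matrix.sub_mul, Matrix.mul_sub]
      abel
    have e2 : Mᴴ * M * (Mᴴ * M) * G * (Mᴴ * M) = Mᴴ * M * (Mᴴ * M) := by
      calc Mᴴ * M * (Mᴴ * M) * G * (Mᴴ * M) = Mᴴ * M * (Mᴴ * M * G * (Mᴴ * M)) := by
            simp only [Matrix.mul_assoc]
        _ = _ := by rw [hHGH]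
    rw [e1, e2, hHGH, sub_self, sub_self, sub_zero]
  refine ⟨?_, ?_, ?_, ?_⟩
  · rw [hP, Matrix.mul_assoc, Matrix.mul_assoc G, hMGH]
  · rw [hP, Matrix.mul_assoc G, ← Matrix.mul_assoc, hGHG]
  · rw [hP, Matrix.IsHermitian, Matrix.conjTranspose_mul, Matrix.conjTranspose_mul,
      Matrix.conjTranspose_conjTranspose, hGherm, Matrix.mul_assoc]
  · rw [hP, Matrix.IsHermitian, Matrix.mul_assoc, hGH]

/-- The trace norm `sup_{‖X‖_∞ ≤ 1} |φ(X)|` of a functional on `𝒜^{⊗ n}`, with respect to the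
operator norm on `𝒜^{⊗ n} ⊆ M_d(ℂ)^{⊗ n}`. -/
def traceNorm {d n : ℕ} {𝒜 : StarSubalgebra ℂ (Matrix (Fin d) (Fin d) ℂ)}
    (φ : chainAlg 𝒜 n →ₗ[ℂ] ℂ) : ℝ :=
  sSup {x : ℝ | ∃ X : chainAlg 𝒜 n,
    ‖Matrix.toEuclideanCLM (𝕜 := ℂ) (X : Matrix (Fin n → Fin d) (Fin n → Fin d) ℂ)‖ ≤ 1 ∧
      x = ‖φ X‖}

/-! ### Spectral state reconstruction -/

/-- Estimates of `Ω`, `Ω_(·)`, `Ω(1)` and `τΩ`, in coordinates. -/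
structure LocalEstimates {d : ℕ} (𝒜 : StarSubalgebra ℂ (Matrix (Fin d) (Fin d) ℂ))
    (p q : ℕ) where
  Omega : Matrix (Fin p) (Fin q) ℂ
  OmegaSite : 𝒜 →ₗ[ℂ] Matrix (Fin p) (Fin q) ℂ
  OmegaOne : Fin p → ℂ
  tauOmega : Fin q → ℂ

namespace LocalEstimates

variable {d p q m : ℕ} {𝒜 : StarSubalgebra ℂ (Matrix (Fin d) (Fin d) ℂ)}
  (est : LocalEstimates 𝒜 p q) (U : Matrix (Fin p) (Fin m) ℂ)

/-- `ê = Ûᴴ Ω(1)^`. -/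
def eHat : Fin m → ℂ := Uᴴ *ᵥ est.OmegaOne

/-- `ρ̂ = (τΩ)^ (Ûᴴ Ω̂)⁺`. -/
def rhoHat : Fin m → ℂ := est.tauOmega ᵥ* pinv (Uᴴ * est.Omega)

/-- `K̂_A = Ûᴴ Ω̂_A (Ûᴴ Ω̂)⁺`. -/
def KHat (A : 𝒜) : Matrix (Fin m) (Fin m) ℂ :=
  Uᴴ * est.OmegaSite A * pinv (Uᴴ * est.Omega)

/-- `ρ̂ K̂_{A₁} ⋯ K̂_{A_t} ê`. -/
def word {t : ℕ} (A : Fin t → 𝒜) : ℂ :=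
  est.rhoHat U ⬝ᵥ ((List.ofFn fun i => est.KHat U (A i)).prod *ᵥ est.eHat U)

/-- The reconstruction `ω̂_t`: the linear functional on `𝒜^{⊗ t}` with
`ω̂_t(A₁ ⊗ ⋯ ⊗ A_t) = ρ̂ K̂_{A₁} ⋯ K̂_{A_t} ê`, obtained by expanding the argument in the product
basis of an orthonormal basis `Z` of `𝒜` (see `reconstruction_elem`). -/
def reconstruction {k : ℕ} (Z : HSBasis 𝒜 k) (t : ℕ) : chainAlg 𝒜 t →ₗ[ℂ] ℂ where
  toFun X := ∑ κ : Fin t → Fin k,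
    (elem (fun i => (Z.basis (κ i) : Matrix (Fin d) (Fin d) ℂ)) *
      (X : Matrix (Fin t → Fin d) (Fin t → Fin d) ℂ)).trace *
        est.word U fun i => Z.basis (κ i)
  map_add' X X' := by
    simp [mul_add, add_mul, Finset.sum_add_distrib]
  map_smul' c X := by
    simp [Finset.mul_sum, mul_assoc]

theorem reconstruction_elem {k : ℕ} (Z : HSBasis 𝒜 k) (t : ℕ) (A : Fin t → 𝒜) :
    est.reconstruction U Z t ⟨elem fun i => (A i : Matrix (Fin d) (Fin d) ℂ), elem_mem A⟩ =
      est.word U A := by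
  let K : Fin t → (𝒜 →ₗ[ℂ] Matrix (Fin m) (Fin m) ℂ) := fun _ =>
    { toFun := est.KHat U
      map_add' := fun B C => by simp [KHat, Matrix.mul_add, Matrix.add_mul]
      map_smul' := fun c B => by simp [KHat] }
  let ev : Matrix (Fin m) (Fin m) ℂ →ₗ[ℂ] ℂ :=
    { toFun := fun P => est.rhoHat U ⬝ᵥ (P *ᵥ est.eHat U)
      map_add' := fun B C => by simp [Matrix.add_mulVec]
      map_smul' := fun c B => by simp [Matrix.smul_mulVec] }
  let W : MultilinearMap ℂ (fun _ : Fin t => 𝒜) ℂ :=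
    ev.compMultilinearMap
      ((MultilinearMap.mkPiAlgebraFin ℂ t (Matrix (Fin m) (Fin m) ℂ)).compLinearMap K)
  have hW : ∀ B : Fin t → 𝒜, W B = est.word U B := fun B => by
    simp only [W, ev, K, word, LinearMap.compMultilinearMap_apply,
      MultilinearMap.compLinearMap_apply, MultilinearMap.mkPiAlgebraFin_apply]
    rfl
  have hA : ∀ B : 𝒜, ∑ j, ((Z.basis j : Matrix (Fin d) (Fin d) ℂ) *
      (B : Matrix (Fin d) (Fin d) ℂ)).trace • Z.basis j = B := by
    intro B
    conv_rhs => rw [← Z.basis.sum_repr B]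
    refine Finset.sum_congr rfl fun j _ => ?_
    congr 1
    have hB : (B : Matrix (Fin d) (Fin d) ℂ) =
        ∑ i, Z.basis.repr B i • (Z.basis i : Matrix (Fin d) (Fin d) ℂ) := by
      conv_lhs => rw [← Z.basis.sum_repr B]
      rw [AddSubmonoidClass.coe_finsetSum]
      rfl
    rw [hB, Matrix.mul_sum, Matrix.trace_sum]
    simp [Z.trace_mul]
  have htr : ∀ B C : Fin t → Matrix (Fin d) (Fin d) ℂ,
      (elem B * elem C).trace = ∏ i, (B i * C i).trace := by
    intro B C
    simp only [Matrix.trace, Matrix.diag_apply, Matrix.mul_apply, elem, Matrix.of_apply,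
      ← Finset.prod_mul_distrib]
    rw [Finset.prod_univ_sum]
    simp only [Fintype.piFinset_univ, Finset.prod_univ_sum]
  have h1 : est.word U A = W fun i => ∑ j, ((Z.basis j : Matrix (Fin d) (Fin d) ℂ) *
      (A i : Matrix (Fin d) (Fin d) ℂ)).trace • Z.basis j := by
    rw [← hW]; congr 1; funext i; exact (hA (A i)).symm
  rw [h1, MultilinearMap.map_sum]
  refine Finset.sum_congr rfl fun κ _ => ?_
  rw [MultilinearMap.map_smul_univ, hW, htr, smul_eq_mul]

end LocalEstimates

end FCS

end

/-! Perturbing a product of `t` matrices in an operator norm on the memory would produce powers of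
the norms of `𝔼_A`, exponential in `t`. Instead, row vectors are measured by a norm that the chain
itself provides: a family `φ` has size `c` (`VBdd`) if attaching any number of exact sites and then
`e` on its right gives a functional of norm at most `c`. Appending an exact site cannot increase
this size, because it only lengthens the half chain (`VBdd.mul_site`).

The one-site algebra is traded for all of `M_d` by composing with the trace-orthogonal projection
onto `𝒜` (`siteCoeff`). The density matrices of the extended state lie in the chain algebras, so the
extension stays positive and has norm one (`MatrixRealization.fbdd_state`).

`Ω` factors through the memory as `L * R`. A change of basis achieves `Uᴴ * L = 1`
(`exists_normalized`). If `a` bounds `(Uᴴ * Ω)ᴴ` from below, every covector `g` is then `ρ 𝔼_Y` with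
`‖Y‖₂ ≤ ‖g‖₂`, and every vector `v` is `𝔼_C e` with `‖C‖₂ ≤ ‖v‖₂ / a` (`normingFrame`). In these
coordinates `K̂_A = 𝔼_A (1 + Θ) + Δ_A`, `ρ̂ = ρ (1 + Θ) + η` and `ê = e + ζ`, where `Θ = Uᴴ (Ω - Ω̂)
(Uᴴ Ω̂)⁺`.

A defect `Θ` or `Δ` is bounded by cutting the chain at it with a basis of the memory: this gives `m`
products of a left and a right functional, whose norms multiply (`FBdd.kronecker`), and
Cauchy–Schwarz turns the sum into a factor `√m`. Telescoping yields the error `(1 + α) (1 + β) ^ t *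
(1 + γ) - 1` (`fbdd_perturbation`), with `α, γ = O(ε)` and `β = ε / t`. The lower bounds for `Uᴴ Ω̂`
and `Uᴴ Ω` come from a Weyl inequality (`IsTruncatedLeftSVD.le_vnorm`). Both parts of the theorem
are one estimate with a parameter `D ≥ √m`: `D = m`, or `D = dB`, because `m ≤ dim ℬ ≤ dB²`. -/

noncomputable section

namespace FCS

open scoped Matrix.Norms.L2Operator

/-! ### Euclidean norms of coordinate vectors and operator norms of matrices -/

section Norms

variable {ι κ μ : Type*} [Fintype ι] [Fintype κ] [Fintype μ]

/-- The Euclidean norm of a coordinate vector over an arbitrary finite index type. -/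
def vnorm (v : ι → ℂ) : ℝ := ‖(WithLp.toLp 2 v : EuclideanSpace ℂ ι)‖

theorem vnorm_nonneg (v : ι → ℂ) : 0 ≤ vnorm v := norm_nonneg _

theorem vnorm_sq (v : ι → ℂ) : vnorm v ^ 2 = ∑ i, ‖v i‖ ^ 2 :=
  EuclideanSpace.norm_sq_eq _

theorem vnorm_eq_sqrt (v : ι → ℂ) : vnorm v = √(∑ i, ‖v i‖ ^ 2) :=
  EuclideanSpace.norm_eq _

theorem euclNorm_eq_vnorm {p : ℕ} (v : Fin p → ℂ) : euclNorm v = vnorm v :=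
  (vnorm_eq_sqrt v).symm

theorem vnorm_sub_le (u v : ι → ℂ) : vnorm u - vnorm v ≤ vnorm (u - v) :=
  norm_sub_norm_le (WithLp.toLp 2 u : EuclideanSpace ℂ ι) (WithLp.toLp 2 v)

theorem vnorm_eq_zero {v : ι → ℂ} (h : vnorm v = 0) : v = 0 := by
  have : (WithLp.toLp 2 v : EuclideanSpace ℂ ι) = 0 := norm_eq_zero.mp h
  simpa using congrArg WithLp.ofLp this

theorem vnorm_pos {v : ι → ℂ} (h : v ≠ 0) : 0 < vnorm v :=
  (vnorm_nonneg v).lt_of_ne fun h0 => h (vnorm_eq_zero h0.symm)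

theorem vnorm_star (v : ι → ℂ) : vnorm (star v) = vnorm v := by
  simp [vnorm_eq_sqrt]

theorem norm_dotProduct_le (u v : ι → ℂ) : ‖u ⬝ᵥ v‖ ≤ vnorm u * vnorm v := by
  have h := norm_inner_le_norm (𝕜 := ℂ) (WithLp.toLp 2 (star u) : EuclideanSpace ℂ ι)
    (WithLp.toLp 2 v)
  rw [EuclideanSpace.inner_toLp_toLp, star_star, dotProduct_comm] at h
  calc _ ≤ _ := h
    _ = vnorm u * vnorm v := by rw [← vnorm_star u]; rfl

theorem star_dotProduct_self (v : ι → ℂ) : star v ⬝ᵥ v = ((vnorm v ^ 2 : ℝ) : ℂ) := by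
  rw [vnorm_sq, dotProduct]
  push_cast
  exact Finset.sum_congr rfl fun i _ => by simp [Complex.conj_mul']

theorem vnorm_le_of_norm_dotProduct_le {v : ι → ℂ} {c : ℝ} (hc : 0 ≤ c)
    (h : ∀ u, ‖u ⬝ᵥ v‖ ≤ c * vnorm u) : vnorm v ≤ c := by
  have h1 := h (star v)
  rw [star_dotProduct_self, vnorm_star, Complex.norm_real, Real.norm_of_nonneg (by positivity)]
    at h1
  by_contra hlt
  push Not at hlt
  nlinarith [vnorm_nonneg v]

theorem vnorm_mulVec_le [DecidableEq κ] (A : Matrix ι κ ℂ) (x : κ → ℂ) :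
    vnorm (A *ᵥ x) ≤ ‖A‖ * vnorm x :=
  Matrix.l2_opNorm_mulVec A (WithLp.toLp 2 x)

theorem norm_dotProduct_mulVec_le [DecidableEq κ] (A : Matrix ι κ ℂ) (y : ι → ℂ) (x : κ → ℂ) :
    ‖y ⬝ᵥ A *ᵥ x‖ ≤ ‖A‖ * vnorm y * vnorm x := by
  calc _ ≤ vnorm y * (‖A‖ * vnorm x) :=
        (norm_dotProduct_le _ _).trans
          (mul_le_mul_of_nonneg_left (vnorm_mulVec_le A x) (vnorm_nonneg y))
    _ = _ := by ring

theorem opNorm_le_of_vnorm [DecidableEq κ] {A : Matrix ι κ ℂ} {c : ℝ} (hc : 0 ≤ c)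
    (h : ∀ x, vnorm (A *ᵥ x) ≤ c * vnorm x) : ‖A‖ ≤ c := by
  rw [Matrix.l2_opNorm_def]
  exact ContinuousLinearMap.opNorm_le_bound _ hc fun x => h (WithLp.ofLp x)

theorem opNorm_le_of_dotProduct [DecidableEq κ] {A : Matrix ι κ ℂ} {c : ℝ} (hc : 0 ≤ c)
    (h : ∀ y x, ‖y ⬝ᵥ A *ᵥ x‖ ≤ c * vnorm y * vnorm x) : ‖A‖ ≤ c :=
  opNorm_le_of_vnorm hc fun x =>
    vnorm_le_of_norm_dotProduct_le (mul_nonneg hc (vnorm_nonneg x)) fun y =>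
      (h y x).trans_eq (by ring)

/-- The Hilbert–Schmidt norm over arbitrary finite index types. -/
def frob (A : Matrix ι κ ℂ) : ℝ := vnorm fun p : ι × κ => A p.1 p.2

theorem frob_nonneg (A : Matrix ι κ ℂ) : 0 ≤ frob A := vnorm_nonneg _

theorem frob_sq (A : Matrix ι κ ℂ) : frob A ^ 2 = ∑ i, ∑ j, ‖A i j‖ ^ 2 := by
  rw [frob, vnorm_sq, Fintype.sum_prod_type]

theorem frob_eq_sqrt (A : Matrix ι κ ℂ) : frob A = √(∑ i, ∑ j, ‖A i j‖ ^ 2) := by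
  rw [← frob_sq, Real.sqrt_sq (frob_nonneg A)]

theorem hsNorm_eq_frob {p q : ℕ} (A : Matrix (Fin p) (Fin q) ℂ) : hsNorm A = frob A :=
  (frob_eq_sqrt A).symm

theorem frob_sq_rows (A : Matrix ι κ ℂ) : frob A ^ 2 = ∑ i, vnorm (A i) ^ 2 := by
  simp only [frob_sq, vnorm_sq]

theorem frob_sq_cols (A : Matrix ι κ ℂ) : frob A ^ 2 = ∑ j, vnorm (Aᵀ j) ^ 2 := by
  simp only [frob_sq, vnorm_sq, Matrix.transpose_apply]
  exact Finset.sum_comm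

theorem vnorm_mulVec_le_frob (A : Matrix ι κ ℂ) (x : κ → ℂ) :
    vnorm (A *ᵥ x) ≤ frob A * vnorm x := by
  refine le_of_sq_le_sq ?_ (mul_nonneg (frob_nonneg _) (vnorm_nonneg _))
  rw [mul_pow, frob_sq_rows, vnorm_sq, Finset.sum_mul]
  refine Finset.sum_le_sum fun i _ => ?_
  rw [← mul_pow]
  exact pow_le_pow_left₀ (norm_nonneg _) (norm_dotProduct_le _ _) 2

theorem opNorm_le_frob [DecidableEq κ] (A : Matrix ι κ ℂ) : ‖A‖ ≤ frob A :=
  opNorm_le_of_vnorm (frob_nonneg A) (vnorm_mulVec_le_frob A)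

theorem vnorm_tensor (y : ι → ℂ) (z : κ → ℂ) :
    vnorm (fun p : ι × κ => y p.1 * z p.2) = vnorm y * vnorm z := by
  rw [← Real.sqrt_sq (vnorm_nonneg (fun p : ι × κ => y p.1 * z p.2)),
    ← Real.sqrt_sq (mul_nonneg (vnorm_nonneg y) (vnorm_nonneg z)), mul_pow, vnorm_sq, vnorm_sq,
    vnorm_sq, Fintype.sum_prod_type, Finset.sum_mul_sum]
  simp [mul_pow]

theorem vnorm_comp_equiv (e : ι ≃ κ) (v : κ → ℂ) : vnorm (v ∘ e) = vnorm v := by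
  rw [vnorm_eq_sqrt, vnorm_eq_sqrt]
  simp [e.sum_comp fun k => ‖v k‖ ^ 2]

theorem opNorm_reindex_le [DecidableEq ι] [DecidableEq κ] (e : ι ≃ κ) (A : Matrix κ κ ℂ) :
    ‖A.submatrix e e‖ ≤ ‖A‖ := by
  refine opNorm_le_of_dotProduct (norm_nonneg _) fun y x => ?_
  have h := norm_dotProduct_mulVec_le A (y ∘ e.symm) (x ∘ e.symm)
  rw [vnorm_comp_equiv, vnorm_comp_equiv] at h
  rwa [Matrix.submatrix_mulVec_equiv, ← comp_equiv_symm_dotProduct]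

/-- `A ⊗ 1` acts by `A` on each slice `x (·, k)` separately, and the squared norms of the slices add
up. -/
theorem opNorm_kronecker_one_le [DecidableEq ι] [DecidableEq κ] (A : Matrix ι ι ℂ) :
    ‖A ⊗ₖ (1 : Matrix κ κ ℂ)‖ ≤ ‖A‖ := by
  refine opNorm_le_of_vnorm (norm_nonneg _) fun x => ?_
  have key : ∀ p : ι × κ, ((A ⊗ₖ (1 : Matrix κ κ ℂ)) *ᵥ x) p = (A *ᵥ fun i => x (i, p.2)) p.1 := by
    intro p
    simp [Matrix.mulVec, dotProduct, Fintype.sum_prod_type, Matrix.one_apply]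
  refine le_of_sq_le_sq ?_ (mul_nonneg (norm_nonneg _) (vnorm_nonneg _))
  rw [mul_pow, vnorm_sq, vnorm_sq, Fintype.sum_prod_type_right, Fintype.sum_prod_type_right,
    Finset.mul_sum]
  refine Finset.sum_le_sum fun k _ => ?_
  have h := pow_le_pow_left₀ (vnorm_nonneg _) (vnorm_mulVec_le A fun i => x (i, k)) 2
  rw [mul_pow, vnorm_sq, vnorm_sq] at h
  simpa only [key] using h

theorem opNorm_one_kronecker_le [DecidableEq ι] [DecidableEq κ] (A : Matrix ι ι ℂ) :
    ‖(1 : Matrix κ κ ℂ) ⊗ₖ A‖ ≤ ‖A‖ := by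
  have h : (1 : Matrix κ κ ℂ) ⊗ₖ A = (A ⊗ₖ (1 : Matrix κ κ ℂ)).submatrix
      (Equiv.prodComm κ ι) (Equiv.prodComm κ ι) := by
    ext p p'
    exact mul_comm _ _
  rw [h]
  exact (opNorm_reindex_le _ _).trans (opNorm_kronecker_one_le A)

theorem opNorm_kronecker_le [DecidableEq ι] [DecidableEq κ] (A : Matrix ι ι ℂ)
    (B : Matrix κ κ ℂ) : ‖A ⊗ₖ B‖ ≤ ‖A‖ * ‖B‖ := by
  have h : A ⊗ₖ B = (A ⊗ₖ (1 : Matrix κ κ ℂ)) * ((1 : Matrix ι ι ℂ) ⊗ₖ B) := by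
    rw [← Matrix.mul_kronecker_mul, mul_one, one_mul]
  rw [h]
  exact (Matrix.l2_opNorm_mul _ _).trans (mul_le_mul (opNorm_kronecker_one_le A)
    (opNorm_one_kronecker_le B) (norm_nonneg _) (norm_nonneg _))

end Norms

/-! ### Norm bounds for functionals on full matrix algebras -/

section Functionals

variable {ι κ μ : Type*} [Fintype ι] [Fintype κ] [Fintype μ]
  [DecidableEq ι] [DecidableEq κ] [DecidableEq μ]

omit [DecidableEq ι] [DecidableEq κ] in
theorem sum_comm_pairs {β : Type*} [AddCommMonoid β] (F : ι → ι → κ → κ → β) :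
    ∑ i, ∑ i', ∑ k, ∑ k', F i i' k k' = ∑ k, ∑ k', ∑ i, ∑ i', F i i' k k' := by
  refine (Finset.sum_congr rfl fun i _ => Finset.sum_comm.trans
    (Finset.sum_congr rfl fun k _ => Finset.sum_comm)).trans ?_
  exact Finset.sum_comm.trans (Finset.sum_congr rfl fun k _ => Finset.sum_comm)

omit [DecidableEq ι] [DecidableEq κ] in
theorem sum_comm_interleave {β : Type*} [AddCommMonoid β] (F : κ → κ → ι → ι → β) :
    ∑ k, ∑ k', ∑ i, ∑ i', F k k' i i' = ∑ i, ∑ k, ∑ i', ∑ k', F k k' i i' := by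
  refine (Finset.sum_congr rfl fun k _ => ?_).trans Finset.sum_comm
  exact Finset.sum_comm.trans (Finset.sum_congr rfl fun i _ => Finset.sum_comm)

/-- The functional with coefficient matrix `T`, evaluated at `W`. -/
def pairing (T W : Matrix κ κ ℂ) : ℂ := ∑ i, ∑ j, W i j * T i j

/-- The functional on `M_κ(ℂ)` with coefficient matrix `T` has norm at most `c`, with respect to
the operator norm on `M_κ(ℂ)`. -/
def FBdd (T : Matrix κ κ ℂ) (c : ℝ) : Prop := ∀ W : Matrix κ κ ℂ, ‖pairing T W‖ ≤ c * ‖W‖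

omit [DecidableEq κ] in
theorem pairing_add (S T W : Matrix κ κ ℂ) : pairing (S + T) W = pairing S W + pairing T W := by
  simp [pairing, mul_add, Finset.sum_add_distrib]

theorem FBdd.mono {T : Matrix κ κ ℂ} {c c' : ℝ} (h : FBdd T c) (hc : c ≤ c') : FBdd T c' :=
  fun W => (h W).trans (mul_le_mul_of_nonneg_right hc (norm_nonneg W))

theorem FBdd.add {S T : Matrix κ κ ℂ} {a b : ℝ} (hS : FBdd S a) (hT : FBdd T b) :
    FBdd (S + T) (a + b) := fun W => by
  rw [pairing_add, add_mul]
  exact (norm_add_le _ _).trans (add_le_add (hS W) (hT W))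

theorem FBdd.zero : FBdd (0 : Matrix κ κ ℂ) 0 := fun W => by simp [pairing]

theorem FBdd.sum {α : Type*} (s : Finset α) {T : α → Matrix κ κ ℂ} {c : α → ℝ}
    (h : ∀ a ∈ s, FBdd (T a) (c a)) : FBdd (∑ a ∈ s, T a) (∑ a ∈ s, c a) := by
  classical
  induction s using Finset.induction_on with
  | empty => simpa using FBdd.zero
  | insert a s ha ih =>
    rw [Finset.sum_insert ha, Finset.sum_insert ha]
    exact (h a (Finset.mem_insert_self a s)).add
      (ih fun b hb => h b (Finset.mem_insert_of_mem hb))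

theorem FBdd.reindex {T : Matrix κ κ ℂ} {c : ℝ} (hc : 0 ≤ c) (h : FBdd T c) (e : ι ≃ κ) :
    FBdd (T.submatrix e e) c := fun W => by
  have h1 : pairing (T.submatrix e e) W = pairing T (W.submatrix e.symm e.symm) := by
    simp only [pairing, Matrix.submatrix_apply]
    rw [← e.symm.sum_comp]
    refine Finset.sum_congr rfl fun i _ => ?_
    rw [← e.symm.sum_comp]
    simp
  rw [h1]
  exact (h _).trans (mul_le_mul_of_nonneg_left (opNorm_reindex_le _ _) hc)

omit [DecidableEq ι] [DecidableEq κ] in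
theorem pairing_kronecker (T : Matrix (ι × κ) (ι × κ) ℂ) (A : Matrix ι ι ℂ) (C : Matrix κ κ ℂ) :
    pairing T (A ⊗ₖ C) = pairing (Matrix.of fun i i' => ∑ k, ∑ k', C k k' * T (i, k) (i', k')) A := by
  simp only [pairing, Fintype.sum_prod_type, Matrix.kroneckerMap_apply, Matrix.of_apply,
    Finset.mul_sum]
  refine Finset.sum_congr rfl fun i _ => ?_
  rw [Finset.sum_comm]
  refine Finset.sum_congr rfl fun i' _ => Finset.sum_congr rfl fun k _ =>
    Finset.sum_congr rfl fun k' _ => by ring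

/-- Evaluating the slice at `A` is evaluating `T` at `A ⊗ C`, and the operator norm is
submultiplicative on tensor products. -/
theorem FBdd.slice_right {T : Matrix (ι × κ) (ι × κ) ℂ} {c : ℝ} (hc : 0 ≤ c) (h : FBdd T c)
    (C : Matrix κ κ ℂ) :
    FBdd (Matrix.of fun i i' => ∑ k, ∑ k', C k k' * T (i, k) (i', k')) (c * ‖C‖) := fun A => by
  rw [← pairing_kronecker]
  calc _ ≤ c * ‖A ⊗ₖ C‖ := h _
    _ ≤ c * (‖A‖ * ‖C‖) := mul_le_mul_of_nonneg_left (opNorm_kronecker_le A C) hc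
    _ = _ := by ring

theorem FBdd.slice_left {T : Matrix (ι × κ) (ι × κ) ℂ} {c : ℝ} (hc : 0 ≤ c) (h : FBdd T c)
    (C : Matrix ι ι ℂ) :
    FBdd (Matrix.of fun k k' => ∑ i, ∑ i', C i i' * T (i, k) (i', k')) (c * ‖C‖) :=
  (h.reindex hc (Equiv.prodComm κ ι)).slice_right hc C

/-- A functional is completely bounded with the same constant. Applying `T` to the blocks of `W`
gives a matrix `Q`; a matrix element of `Q` between `y` and `x` is `T` evaluated at the compression
`R` of `W` by these vectors, and `‖R‖ ≤ ‖W‖ ‖y‖ ‖x‖`. Then `S` is applied to `Q`. -/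
theorem FBdd.kronecker {S : Matrix ι ι ℂ} {T : Matrix κ κ ℂ} {a b : ℝ} (ha : 0 ≤ a) (hb : 0 ≤ b)
    (hS : FBdd S a) (hT : FBdd T b) : FBdd (S ⊗ₖ T) (a * b) := fun W => by
  let Q : Matrix ι ι ℂ := Matrix.of fun i i' => pairing T (Matrix.of fun k k' => W (i, k) (i', k'))
  have hQ : ‖Q‖ ≤ b * ‖W‖ := by
    refine opNorm_le_of_dotProduct (mul_nonneg hb (norm_nonneg _)) fun y x => ?_
    let R : Matrix κ κ ℂ := Matrix.of fun k k' => ∑ i, ∑ i', y i * W (i, k) (i', k') * x i'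
    have hR : ‖R‖ ≤ ‖W‖ * (vnorm y * vnorm x) := by
      refine opNorm_le_of_dotProduct
        (mul_nonneg (norm_nonneg _) (mul_nonneg (vnorm_nonneg _) (vnorm_nonneg _))) fun z u => ?_
      have e : z ⬝ᵥ R *ᵥ u =
          (fun p : ι × κ => y p.1 * z p.2) ⬝ᵥ W *ᵥ (fun p : ι × κ => x p.1 * u p.2) := by
        simp only [R, dotProduct, Matrix.mulVec, Matrix.of_apply, Fintype.sum_prod_type,
          Finset.mul_sum, Finset.sum_mul]
        rw [sum_comm_interleave]
        refine Finset.sum_congr rfl fun i _ => Finset.sum_congr rfl fun k _ =>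
          Finset.sum_congr rfl fun i' _ => Finset.sum_congr rfl fun k' _ => by ring
      rw [e]
      refine (norm_dotProduct_mulVec_le _ _ _).trans_eq ?_
      rw [vnorm_tensor, vnorm_tensor]
      ring
    have e : y ⬝ᵥ Q *ᵥ x = pairing T R := by
      simp only [Q, R, pairing, dotProduct, Matrix.mulVec, Matrix.of_apply, Finset.mul_sum,
        Finset.sum_mul]
      rw [sum_comm_pairs]
      refine Finset.sum_congr rfl fun i _ => Finset.sum_congr rfl fun k _ =>
        Finset.sum_congr rfl fun i' _ => Finset.sum_congr rfl fun k' _ => by ring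
    rw [e]
    calc _ ≤ b * ‖R‖ := hT R
      _ ≤ b * (‖W‖ * (vnorm y * vnorm x)) := mul_le_mul_of_nonneg_left hR hb
      _ = _ := by ring
  have e : pairing (S ⊗ₖ T) W = pairing S Q := by
    simp only [Q, pairing, Fintype.sum_prod_type, Matrix.kroneckerMap_apply, Matrix.of_apply,
      Finset.sum_mul]
    refine Finset.sum_congr rfl fun i _ => ?_
    rw [Finset.sum_comm]
    refine Finset.sum_congr rfl fun i' _ => Finset.sum_congr rfl fun k _ =>
      Finset.sum_congr rfl fun k' _ => by ring
  rw [e]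
  calc _ ≤ a * ‖Q‖ := hS Q
    _ ≤ a * (b * ‖W‖) := mul_le_mul_of_nonneg_left hQ ha
    _ = _ := by ring

/-- Norm bound for the functional `A ⊗ X ↦ ∑ G_{aa'} A_{aa'} X`, where `X ↦ G_{aa'} X` is the
slice of a contractive functional with `B_{aa'}`. -/
theorem FBdd.block_slice {T : Matrix (ι × κ) (ι × κ) ℂ} (h : FBdd T 1)
    (B : μ → μ → Matrix ι ι ℂ) :
    FBdd (Matrix.of fun (p p' : μ × κ) => ∑ i, ∑ i', B p.1 p'.1 i i' * T (i, p.2) (i', p'.2))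
      (√(Fintype.card μ : ℝ) * √(∑ a, ∑ a', frob (B a a') ^ 2)) := fun W => by
  let β : μ → ℝ := fun a' => √(∑ a, frob (B a a') ^ 2)
  have hβ : ∀ a', β a' ^ 2 = ∑ a, frob (B a a') ^ 2 := fun a' =>
    Real.sq_sqrt (Finset.sum_nonneg fun a _ => sq_nonneg _)
  -- One block column of `W` at a time: its norm needs no dimension factor, and the factor `√(card
  -- μ)` arises only from Cauchy–Schwarz over the columns `a'`.
  let Q : μ → Matrix (ι × κ) (ι × κ) ℂ := fun a' =>
    ∑ a, B a a' ⊗ₖ (Matrix.of fun k k' => W (a, k) (a', k'))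
  have hQ : ∀ a', ‖Q a'‖ ≤ β a' * ‖W‖ := by
    intro a'
    have hc : 0 ≤ β a' * ‖W‖ := mul_nonneg (Real.sqrt_nonneg _) (norm_nonneg _)
    refine opNorm_le_of_dotProduct hc fun y x => ?_
    -- For fixed `i, i'` the sum over `a` becomes one matrix element of `W` between product vectors,
    -- so the entries of `B` enter through the Euclidean norm of `a ↦ B a a' i i'`.
    have e : y ⬝ᵥ Q a' *ᵥ x = ∑ i, ∑ i',
        (fun p : μ × κ => B p.1 a' i i' * y (i, p.2)) ⬝ᵥ
          W *ᵥ (fun p : μ × κ => (Pi.single a' 1 : μ → ℂ) p.1 * x (i', p.2)) := by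
      have hW : ∀ (i' : ι) (p : μ × κ),
          (W *ᵥ fun p : μ × κ => (Pi.single a' 1 : μ → ℂ) p.1 * x (i', p.2)) p =
            ∑ k', W p (a', k') * x (i', k') := by
        intro i' p
        simp only [Matrix.mulVec, dotProduct, Fintype.sum_prod_type]
        rw [Finset.sum_eq_single a' (fun b _ hb => by simp [hb]) (by simp)]
        simp
      simp only [dotProduct, hW]
      simp only [Q, Matrix.mulVec, dotProduct, Matrix.sum_apply, Matrix.kroneckerMap_apply,
        Matrix.of_apply, Fintype.sum_prod_type, Finset.mul_sum, Finset.sum_mul]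
      refine Finset.sum_congr rfl fun i _ => ?_
      rw [Finset.sum_comm]
      refine Finset.sum_congr rfl fun i' _ => ?_
      refine Eq.trans (Finset.sum_congr rfl fun k _ => Finset.sum_comm) (Finset.sum_comm.trans ?_)
      refine Finset.sum_congr rfl fun a _ => Finset.sum_congr rfl fun k _ =>
        Finset.sum_congr rfl fun k' _ => by ring
    have hx : ∀ i', vnorm (fun p : μ × κ => (Pi.single a' 1 : μ → ℂ) p.1 * x (i', p.2)) =
        vnorm fun k => x (i', k) := by
      intro i'
      rw [vnorm_tensor (Pi.single a' 1 : μ → ℂ) fun k => x (i', k)]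
      have h1 : vnorm (Pi.single a' 1 : μ → ℂ) = 1 := by
        rw [vnorm_eq_sqrt, Finset.sum_eq_single a' (fun b _ hb => by simp [hb]) (by simp)]
        simp
      rw [h1, one_mul]
    have hb : ∑ p : ι × ι, vnorm (fun a => B a a' p.1 p.2) ^ 2 = β a' ^ 2 := by
      simp only [hβ, frob_sq, vnorm_sq, Fintype.sum_prod_type]
      exact (Finset.sum_congr rfl fun i _ => Finset.sum_comm).trans Finset.sum_comm
    have hyx : ∑ p : ι × ι, (vnorm (fun k => y (p.1, k)) * vnorm fun k => x (p.2, k)) ^ 2 =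
        (vnorm y * vnorm x) ^ 2 := by
      simp only [mul_pow, vnorm_sq, Fintype.sum_prod_type, Finset.sum_mul_sum]
    rw [e]
    calc _ ≤ ∑ p : ι × ι, ‖W‖ * (vnorm (fun a => B a a' p.1 p.2) *
          (vnorm (fun k => y (p.1, k)) * vnorm fun k => x (p.2, k))) := by
          rw [Fintype.sum_prod_type]
          refine (norm_sum_le _ _).trans (Finset.sum_le_sum fun i _ =>
            (norm_sum_le _ _).trans (Finset.sum_le_sum fun i' _ => ?_))
          refine (norm_dotProduct_mulVec_le _ _ _).trans_eq ?_
          rw [hx, vnorm_tensor (fun a => B a a' i i') fun k => y (i, k)]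
          ring
      _ ≤ ‖W‖ * (√(∑ p : ι × ι, vnorm (fun a => B a a' p.1 p.2) ^ 2) *
          √(∑ p : ι × ι, (vnorm (fun k => y (p.1, k)) * vnorm fun k => x (p.2, k)) ^ 2)) := by
          rw [← Finset.mul_sum]
          exact mul_le_mul_of_nonneg_left (Real.sum_mul_le_sqrt_mul_sqrt _ _ _) (norm_nonneg _)
      _ = _ := by
          rw [hb, hyx, Real.sqrt_sq (Real.sqrt_nonneg _),
            Real.sqrt_sq (mul_nonneg (vnorm_nonneg _) (vnorm_nonneg _))]
          ring
  have e : pairing (Matrix.of fun (p p' : μ × κ) =>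
      ∑ i, ∑ i', B p.1 p'.1 i i' * T (i, p.2) (i', p'.2)) W = ∑ a', pairing T (Q a') := by
    simp only [Q, pairing, Matrix.sum_apply, Matrix.kroneckerMap_apply, Matrix.of_apply,
      Fintype.sum_prod_type, Finset.mul_sum, Finset.sum_mul]
    refine Eq.trans (Finset.sum_congr rfl fun a _ => Finset.sum_comm) (Finset.sum_comm.trans ?_)
    refine Finset.sum_congr rfl fun a' _ => ?_
    refine (Finset.sum_congr rfl fun a _ => sum_comm_interleave _).trans ?_
    rw [Finset.sum_comm]
    refine Finset.sum_congr rfl fun i _ => ?_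
    rw [Finset.sum_comm]
    refine Finset.sum_congr rfl fun k _ => ?_
    rw [Finset.sum_comm]
    refine Finset.sum_congr rfl fun i' _ => ?_
    rw [Finset.sum_comm]
    refine Finset.sum_congr rfl fun k' _ => Finset.sum_congr rfl fun a _ => by ring
  rw [e]
  calc _ ≤ ∑ a', ‖pairing T (Q a')‖ := norm_sum_le _ _
    _ ≤ ∑ a', 1 * (β a' * ‖W‖) := Finset.sum_le_sum fun a' _ =>
        (h _).trans (mul_le_mul_of_nonneg_left (hQ a') zero_le_one)
    _ = (∑ a', 1 * β a') * ‖W‖ := by rw [Finset.sum_mul]; simp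
    _ ≤ (√(∑ a' : μ, 1 ^ 2) * √(∑ a', β a' ^ 2)) * ‖W‖ :=
        mul_le_mul_of_nonneg_right (Real.sum_mul_le_sqrt_mul_sqrt _ _ _) (norm_nonneg _)
    _ = _ := by
        simp only [hβ]
        rw [Finset.sum_comm]
        simp

/-- A positive functional attains its norm at `1`. -/
theorem FBdd.of_posSemidef {D : Matrix κ κ ℂ} (hD : D.PosSemidef) :
    FBdd Dᵀ (D.trace.re) := fun W => by
  -- `pairing Dᵀ W` is `Tr[W D]`, a sum of vector functionals over the rows of `B`; the squared
  -- norms of the rows sum to the trace.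
  obtain ⟨B, rfl⟩ : ∃ B : Matrix κ κ ℂ, D = Bᴴ * B := by
    open scoped MatrixOrder in
    exact CStarAlgebra.nonneg_iff_eq_star_mul_self.mp (Matrix.nonneg_iff_posSemidef.mpr hD)
  have e : pairing (Bᴴ * B)ᵀ W = ∑ i, B i ⬝ᵥ W *ᵥ star (B i) := by
    calc pairing (Bᴴ * B)ᵀ W = (W * (Bᴴ * B)).trace := rfl
      _ = (B * (W * Bᴴ)).trace := by
        rw [← Matrix.mul_assoc, Matrix.trace_mul_comm]
      _ = _ := rfl
  have htr : (Bᴴ * B).trace.re = ∑ i, vnorm (B i) ^ 2 := by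
    have h : (Bᴴ * B).trace = ((∑ i, vnorm (B i) ^ 2 : ℝ) : ℂ) := by
      rw [Matrix.trace_mul_comm, Complex.ofReal_sum]
      refine Finset.sum_congr rfl fun i _ => ?_
      rw [← star_dotProduct_self, dotProduct_comm]
      rfl
    rw [h, Complex.ofReal_re]
  rw [e, htr, Finset.sum_mul]
  refine (norm_sum_le _ _).trans (Finset.sum_le_sum fun i _ => ?_)
  refine (norm_dotProduct_mulVec_le _ _ _).trans_eq ?_
  rw [vnorm_star]
  ring

end Functionals

/-! ### Matrix product functionals and their perturbations -/

section MatrixProducts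

variable {d m : ℕ}

/-- The product `K_{f₁ g₁} ⋯ K_{fₙ gₙ}`. -/
def kword (K : Fin d → Fin d → Matrix (Fin m) (Fin m) ℂ) {n : ℕ} (f g : Fin n → Fin d) :
    Matrix (Fin m) (Fin m) ℂ :=
  (List.ofFn fun i => K (f i) (g i)).prod

variable (K : Fin d → Fin d → Matrix (Fin m) (Fin m) ℂ)

theorem kword_zero (f g : Fin 0 → Fin d) : kword K f g = 1 := by simp [kword]

theorem kword_append {a b : ℕ} (f g : Fin a → Fin d) (f' g' : Fin b → Fin d) :
    kword K (Fin.append f f') (Fin.append g g') = kword K f g * kword K f' g' := by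
  rw [kword, kword, kword, ← List.prod_append, ← List.ofFn_fin_append]
  congr 2
  funext i
  refine Fin.addCases (fun j => ?_) (fun j => ?_) i <;> simp

theorem kword_cons {n : ℕ} (a b : Fin d) (f g : Fin n → Fin d) :
    kword K (Fin.cons a f : Fin (n + 1) → Fin d) (Fin.cons b g : Fin (n + 1) → Fin d) =
      K a b * kword K f g := by
  simp [kword, List.ofFn_succ]

theorem kword_snoc {n : ℕ} (f g : Fin n → Fin d) (a b : Fin d) :
    kword K (Fin.snoc f a : Fin (n + 1) → Fin d) (Fin.snoc g b : Fin (n + 1) → Fin d) =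
      kword K f g * K a b := by
  rw [kword, List.ofFn_succ']
  simp [kword, List.concat_eq_append]

/-- The family `φ` of row vectors, viewed as a functional on `M_ι(ℂ) ⊗ V`, has norm at most `c`
with respect to the quotient norm of `V` as the image of the algebras on the right half chain. -/
def VBdd {ι : Type*} [Fintype ι] [DecidableEq ι] (e : Fin m → ℂ) (φ : ι → ι → Fin m → ℂ)
    (c : ℝ) : Prop :=
  ∀ N : ℕ, FBdd (Matrix.of fun (p p' : ι × (Fin N → Fin d)) =>
    φ p.1 p'.1 ⬝ᵥ (kword K p.2 p'.2 *ᵥ e)) c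

variable {K} {e : Fin m → ℂ}

/-! ### Row vectors in the norm of the right half chain -/

section Bounds

variable {ι κ : Type*} [Fintype ι] [DecidableEq ι] [Fintype κ] [DecidableEq κ]

theorem VBdd.add {φ ψ : ι → ι → Fin m → ℂ} {a b : ℝ} (hφ : VBdd K e φ a) (hψ : VBdd K e ψ b) :
    VBdd K e (φ + ψ) (a + b) := fun N => by
  convert (hφ N).add (hψ N) using 1
  ext p p'
  simp [add_dotProduct]

theorem VBdd.mono {φ : ι → ι → Fin m → ℂ} {a b : ℝ} (hφ : VBdd K e φ a) (h : a ≤ b) :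
    VBdd K e φ b := fun N => (hφ N).mono h

theorem VBdd.reindex {φ : ι → ι → Fin m → ℂ} {a : ℝ} (ha : 0 ≤ a) (hφ : VBdd K e φ a)
    (u : κ ≃ ι) : VBdd K e (fun k k' => φ (u k) (u k')) a := fun N =>
  (hφ N).reindex ha (u.prodCongr (Equiv.refl _))

/-- The new site is the first site of a half chain of length `N + 1`, and the hypothesis covers
every length. No norm of `K` appears, which is what avoids exponential growth in the number of
sites. -/
theorem VBdd.mul_site {φ : ι → ι → Fin m → ℂ} {c : ℝ} (hc : 0 ≤ c) (hφ : VBdd K e φ c) :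
    VBdd K e (fun p p' : ι × Fin d => φ p.1 p'.1 ᵥ* K p.2 p'.2) c := fun N => by
  let u : (ι × Fin d) × (Fin N → Fin d) ≃ ι × (Fin (N + 1) → Fin d) :=
    (Equiv.prodAssoc _ _ _).trans
      ((Equiv.refl ι).prodCongr (Fin.consEquiv fun _ : Fin (N + 1) => Fin d))
  convert (hφ (N + 1)).reindex hc u using 1
  ext p p'
  have h := kword_cons K p.1.2 p'.1.2 p.2 p'.2
  change (φ p.1.1 p'.1.1 ᵥ* K p.1.2 p'.1.2) ⬝ᵥ (kword K p.2 p'.2 *ᵥ e) =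
    φ p.1.1 p'.1.1 ⬝ᵥ (kword K (Fin.cons p.1.2 p.2 : Fin (N + 1) → Fin d)
      (Fin.cons p'.1.2 p'.2 : Fin (N + 1) → Fin d) *ᵥ e)
  rw [h, ← Matrix.mulVec_mulVec]
  exact (Matrix.dotProduct_mulVec _ _ _).symm

theorem VBdd.dotProduct_self {φ : ι → ι → Fin m → ℂ} {c : ℝ} (hc : 0 ≤ c) (hφ : VBdd K e φ c) :
    FBdd (Matrix.of fun i i' => φ i i' ⬝ᵥ e) c := by
  convert (hφ 0).reindex hc (Equiv.prodUnique ι (Fin 0 → Fin d)).symm using 1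
  ext i i'
  simp [kword_zero]

end Bounds

theorem sum_le_sqrt_mul_sqrt_sum_sq (x : Fin m → ℝ) : ∑ j, x j ≤ √(m : ℝ) * √(∑ j, x j ^ 2) := by
  have h := Real.sum_mul_le_sqrt_mul_sqrt Finset.univ (fun _ : Fin m => (1 : ℝ)) x
  simpa using h

/-- Quantitative nondegeneracy of a matrix product state: the vectors of the right half chain span
`V` with constant `a⁻¹`, and the dual vectors come from observables on `l` sites. -/
structure NormingFrame (K : Fin d → Fin d → Matrix (Fin m) (Fin m) ℂ) (ρ e : Fin m → ℂ)
    (l r : ℕ) (a : ℝ) : Prop where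
  pos : 0 < a
  state : ∀ N : ℕ, FBdd (Matrix.of fun f f' : Fin N → Fin d => ρ ⬝ᵥ (kword K f f' *ᵥ e)) 1
  left : ∀ g : Fin m → ℂ, ∃ Y : Matrix (Fin l → Fin d) (Fin l → Fin d) ℂ, frob Y ≤ vnorm g ∧
    ∀ (N : ℕ) (f f' : Fin N → Fin d), g ⬝ᵥ (kword K f f' *ᵥ e) =
      ∑ h, ∑ h', Y h h' * (ρ ⬝ᵥ (kword K (Fin.append h f) (Fin.append h' f') *ᵥ e))
  right : ∀ v : Fin m → ℂ, ∃ C : Matrix (Fin r → Fin d) (Fin r → Fin d) ℂ,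
    frob C ≤ vnorm v / a ∧ v = ∑ h, ∑ h', C h h' • (kword K h h' *ᵥ e)

/-! ### Perturbation theory in a norming frame -/

namespace NormingFrame

variable {ρ : Fin m → ℂ} {l r : ℕ} {a : ℝ} (F : NormingFrame K ρ e l r a)
  {ι : Type*} [Fintype ι] [DecidableEq ι]

include F

theorem state_append (N : ℕ) : FBdd (Matrix.of fun p p' : (Fin l → Fin d) × (Fin N → Fin d) =>
    ρ ⬝ᵥ (kword K (Fin.append p.1 p.2) (Fin.append p'.1 p'.2) *ᵥ e)) 1 :=
  (F.state (l + N)).reindex zero_le_one (Fin.appendEquiv l N)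

/-- Since `g` is `ρ` preceded by an observable on `l` sites, this functional is a slice of the state
on `l + N` sites. -/
theorem fbdd_vec (g : Fin m → ℂ) (N : ℕ) :
    FBdd (Matrix.of fun f f' : Fin N → Fin d => g ⬝ᵥ (kword K f f' *ᵥ e)) (vnorm g) := by
  obtain ⟨Y, hY, h⟩ := F.left g
  have h' : (Matrix.of fun f f' : Fin N → Fin d => g ⬝ᵥ (kword K f f' *ᵥ e)) =
      Matrix.of fun f f' => ∑ i, ∑ i', Y i i' *
        (ρ ⬝ᵥ (kword K (Fin.append i f) (Fin.append i' f') *ᵥ e)) := by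
    ext f f'
    exact h N f f'
  rw [h']
  refine ((F.state_append N).slice_left zero_le_one Y).mono ?_
  rw [one_mul]
  exact (opNorm_le_frob Y).trans hY

/-- Each `G b b'` has its own observable on the left, so the slice varies with the block;
`FBdd.block_slice` with block indices in `Fin d` produces the factor `√d`. -/
theorem fbdd_site (G : Fin d → Fin d → Fin m → ℂ) (N : ℕ) :
    FBdd (Matrix.of fun p p' : Fin d × (Fin N → Fin d) =>
        G p.1 p'.1 ⬝ᵥ (kword K p.2 p'.2 *ᵥ e))
      (√(d : ℝ) * √(∑ b, ∑ b', vnorm (G b b') ^ 2)) := by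
  choose Y hY h using F.left
  have h' : (Matrix.of fun p p' : Fin d × (Fin N → Fin d) =>
        G p.1 p'.1 ⬝ᵥ (kword K p.2 p'.2 *ᵥ e)) =
      Matrix.of fun p p' => ∑ i, ∑ i', Y (G p.1 p'.1) i i' *
        (ρ ⬝ᵥ (kword K (Fin.append i p.2) (Fin.append i' p'.2) *ᵥ e)) := by
    ext p p'
    exact h _ N p.2 p'.2
  rw [h']
  refine ((F.state_append N).block_slice fun b b' => Y (G b b')).mono ?_
  rw [Fintype.card_fin]
  refine mul_le_mul_of_nonneg_left (Real.sqrt_le_sqrt ?_) (Real.sqrt_nonneg _)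
  exact Finset.sum_le_sum fun b _ => Finset.sum_le_sum fun b' _ =>
    pow_le_pow_left₀ (frob_nonneg _) (hY _) 2

/-- The vector `v` is produced by an observable on `r` sites of the right half chain, so this is a
slice of the test of `φ` at length `r`. -/
theorem dotProduct {φ : ι → ι → Fin m → ℂ} {c : ℝ} (hc : 0 ≤ c) (hφ : VBdd K e φ c)
    (v : Fin m → ℂ) : FBdd (Matrix.of fun i i' => φ i i' ⬝ᵥ v) (c * (vnorm v / a)) := by
  obtain ⟨C, hC, h⟩ := F.right v
  refine FBdd.mono (T := Matrix.of fun i i' => φ i i' ⬝ᵥ v) (c := c * ‖C‖) ?_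
    (mul_le_mul_of_nonneg_left ((opNorm_le_frob C).trans hC) hc)
  convert (hφ r).slice_right hc C using 1
  ext i i'
  conv_lhs => rw [Matrix.of_apply, h]
  simp [dotProduct_sum]

/-- The chain is cut at `Θ` by inserting the standard basis: `φ Θ` is the sum over `j` of the `j`-th
coordinate of `φ`, of size `c / a`, times the `j`-th row of `Θ`, of size its Euclidean norm.
Cauchy–Schwarz over `j` gives `√m`. -/
theorem mul_right {φ : ι → ι → Fin m → ℂ} {c : ℝ} (hc : 0 ≤ c) (hφ : VBdd K e φ c)
    (Θ : Matrix (Fin m) (Fin m) ℂ) :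
    VBdd K e (fun i i' => φ i i' ᵥ* Θ) (c / a * (√(m : ℝ) * frob Θ)) := fun N => by
  have hj : ∀ j ∈ (Finset.univ : Finset (Fin m)), FBdd
      ((Matrix.of fun i i' => φ i i' ⬝ᵥ Pi.single j 1) ⊗ₖ
        (Matrix.of fun f f' : Fin N → Fin d => Θ j ⬝ᵥ (kword K f f' *ᵥ e)))
      (c * (1 / a) * vnorm (Θ j)) := by
    intro j _
    have h1 : vnorm (Pi.single j 1 : Fin m → ℂ) = 1 := by
      rw [vnorm_eq_sqrt, Finset.sum_eq_single j (fun b _ hb => by simp [hb]) (by simp)]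
      simp
    have h2 := F.dotProduct hc hφ (Pi.single j 1)
    rw [h1] at h2
    exact h2.kronecker (mul_nonneg hc (one_div_nonneg.mpr F.pos.le)) (vnorm_nonneg _)
      (F.fbdd_vec _ _)
  refine FBdd.mono (c := ∑ j, c * (1 / a) * vnorm (Θ j)) ?_ ?_
  · convert FBdd.sum _ hj using 1
    ext p p'
    rw [Matrix.of_apply, ← Matrix.dotProduct_mulVec]
    simp only [Matrix.sum_apply, Matrix.kroneckerMap_apply, Matrix.of_apply,
      dotProduct_single, mul_one]
    rfl
  · rw [← Finset.mul_sum, mul_one_div]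
    refine mul_le_mul_of_nonneg_left ?_ (div_nonneg hc F.pos.le)
    refine (sum_le_sqrt_mul_sqrt_sum_sq _).trans_eq ?_
    rw [← frob_sq_rows, Real.sqrt_sq (frob_nonneg _)]

/-- The same cut as in `mul_right`; the rows of `Δ` now depend on the site, and `fbdd_site` replaces
`fbdd_vec`. -/
theorem mul_site {φ : ι → ι → Fin m → ℂ} {c : ℝ} (hc : 0 ≤ c) (hφ : VBdd K e φ c)
    (Δ : Fin d → Fin d → Matrix (Fin m) (Fin m) ℂ) :
    VBdd K e (fun p p' : ι × Fin d => φ p.1 p'.1 ᵥ* Δ p.2 p'.2)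
      (c / a * (√(m : ℝ) * (√(d : ℝ) * √(∑ b, ∑ b', frob (Δ b b') ^ 2)))) := fun N => by
  have hj : ∀ j ∈ (Finset.univ : Finset (Fin m)), FBdd
      (((Matrix.of fun i i' => φ i i' ⬝ᵥ Pi.single j 1) ⊗ₖ
        (Matrix.of fun p p' : Fin d × (Fin N → Fin d) =>
          Δ p.1 p'.1 j ⬝ᵥ (kword K p.2 p'.2 *ᵥ e))).submatrix
            (Equiv.prodAssoc _ _ _) (Equiv.prodAssoc _ _ _))
      (c * (1 / a) * (√(d : ℝ) * √(∑ b, ∑ b', vnorm (Δ b b' j) ^ 2))) := by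
    intro j _
    have h1 : vnorm (Pi.single j 1 : Fin m → ℂ) = 1 := by
      rw [vnorm_eq_sqrt, Finset.sum_eq_single j (fun b _ hb => by simp [hb]) (by simp)]
      simp
    have h2 := F.dotProduct hc hφ (Pi.single j 1)
    rw [h1] at h2
    have h3 : 0 ≤ c * (1 / a) := mul_nonneg hc (one_div_nonneg.mpr F.pos.le)
    have h4 : 0 ≤ √(d : ℝ) * √(∑ b, ∑ b', vnorm (Δ b b' j) ^ 2) :=
      mul_nonneg (Real.sqrt_nonneg _) (Real.sqrt_nonneg _)
    exact (h2.kronecker h3 h4 (F.fbdd_site (fun b b' => Δ b b' j) N)).reindex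
      (mul_nonneg h3 h4) (Equiv.prodAssoc ι (Fin d) (Fin N → Fin d))
  refine FBdd.mono (c := ∑ j, c * (1 / a) * (√(d : ℝ) * √(∑ b, ∑ b', vnorm (Δ b b' j) ^ 2))) ?_ ?_
  · convert FBdd.sum _ hj using 1
    ext p p'
    rw [Matrix.of_apply, ← Matrix.dotProduct_mulVec]
    simp only [Matrix.sum_apply, Matrix.submatrix_apply, Matrix.kroneckerMap_apply,
      Matrix.of_apply, dotProduct_single, mul_one]
    rfl
  · rw [← Finset.mul_sum, mul_one_div, ← Finset.mul_sum, mul_left_comm (√(m : ℝ))]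
    refine mul_le_mul_of_nonneg_left ?_ (div_nonneg hc F.pos.le)
    refine mul_le_mul_of_nonneg_left ?_ (Real.sqrt_nonneg _)
    refine (sum_le_sqrt_mul_sqrt_sum_sq _).trans_eq ?_
    congr 2
    simp only [frob_sq_rows]
    rw [Finset.sum_congr rfl fun j _ => Real.sq_sqrt (Finset.sum_nonneg fun b _ =>
      Finset.sum_nonneg fun b' _ => sq_nonneg (vnorm (Δ b b' j)))]
    rw [Finset.sum_comm]
    exact Finset.sum_congr rfl fun b _ => Finset.sum_comm

/-- Stability of matrix product functionals under perturbation of all their ingredients. -/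
theorem fbdd_perturbation {K' : Fin d → Fin d → Matrix (Fin m) (Fin m) ℂ} {ρ' e' : Fin m → ℂ}
    {Θ : Matrix (Fin m) (Fin m) ℂ} {Δ : Fin d → Fin d → Matrix (Fin m) (Fin m) ℂ}
    {η ζ : Fin m → ℂ} (hK : ∀ b b', K' b b' = K b b' + K b b' * Θ + Δ b b')
    (hρ : ρ' = ρ + ρ ᵥ* Θ + η) (he : e' = e + ζ) {α β γ : ℝ}
    (hα : 1 / a * (√(m : ℝ) * frob Θ) + vnorm η ≤ α)
    (hβ : 1 / a * (√(m : ℝ) * frob Θ) +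
      1 / a * (√(m : ℝ) * (√(d : ℝ) * √(∑ b, ∑ b', frob (Δ b b') ^ 2))) ≤ β)
    (hγ : vnorm ζ / a ≤ γ) (t : ℕ) :
    FBdd (Matrix.of fun f f' : Fin t → Fin d =>
        ρ' ⬝ᵥ (kword K' f f' *ᵥ e') - ρ ⬝ᵥ (kword K f f' *ᵥ e))
      ((1 + α) * (1 + β) ^ t * (1 + γ) - 1) := by
  have ha := F.pos
  have h0 : 0 ≤ 1 / a * (√(m : ℝ) * frob Θ) :=
    mul_nonneg (by positivity) (mul_nonneg (Real.sqrt_nonneg _) (frob_nonneg _))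
  have hα0 : 0 ≤ α := (add_nonneg h0 (vnorm_nonneg _)).trans hα
  have hβ0 : 0 ≤ β := (add_nonneg h0 (by positivity)).trans hβ
  -- `K' - K = K Θ + Δ`. In the first term the factor `K` is absorbed for free before `Θ` is
  -- applied, so only `Θ` and `Δ` cost anything.
  have hpert : ∀ {ι : Type} [Fintype ι] [DecidableEq ι] {φ : ι → ι → Fin m → ℂ} {c : ℝ},
      0 ≤ c → VBdd K e φ c →
      VBdd K e (fun p p' : ι × Fin d => φ p.1 p'.1 ᵥ* (K' p.2 p'.2 - K p.2 p'.2)) (c * β) := by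
    intro ι _ _ φ c hc hφ
    refine VBdd.mono (a := c / a * (√(m : ℝ) * frob Θ) +
      c / a * (√(m : ℝ) * (√(d : ℝ) * √(∑ b, ∑ b', frob (Δ b b') ^ 2)))) ?_ ?_
    · convert (F.mul_right hc (hφ.mul_site hc) Θ).add (F.mul_site hc hφ Δ) using 1
      funext p p'
      rw [Pi.add_apply, Pi.add_apply, hK, Matrix.vecMul_vecMul, ← Matrix.vecMul_add]
      congr 1
      abel
    · calc _ = c * (1 / a * (√(m : ℝ) * frob Θ) +
            1 / a * (√(m : ℝ) * (√(d : ℝ) * √(∑ b, ∑ b', frob (Δ b b') ^ 2)))) := by ring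
        _ ≤ _ := mul_le_mul_of_nonneg_left hβ hc
  -- The exact words keep size one for all lengths; the induction on the error word needs this at
  -- every step.
  have hmain : ∀ n : ℕ,
      VBdd K e (fun f f' : Fin n → Fin d => ρ ᵥ* kword K f f') 1 ∧
      VBdd K e (fun f f' : Fin n → Fin d => ρ' ᵥ* kword K' f f' - ρ ᵥ* kword K f f')
        ((1 + α) * (1 + β) ^ n - 1) := by
    have hnn : ∀ n : ℕ, 0 ≤ (1 + α) * (1 + β) ^ n - 1 := fun n => by
      have := one_le_mul_of_one_le_of_one_le (by linarith : 1 ≤ 1 + α)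
        (one_le_pow₀ (by linarith : 1 ≤ 1 + β) (n := n))
      linarith
    intro n
    induction n with
    | zero =>
      have h1 : VBdd K e (fun _ _ : Fin 0 → Fin d => ρ) 1 := fun N =>
        (F.state N).reindex zero_le_one (Equiv.uniqueProd _ _)
      refine ⟨by simpa only [kword_zero, Matrix.vecMul_one] using h1, ?_⟩
      have h2 : VBdd K e (fun _ _ : Fin 0 → Fin d => η) (vnorm η) := fun N =>
        (F.fbdd_vec η N).reindex (vnorm_nonneg _) (Equiv.uniqueProd _ _)
      refine VBdd.mono (a := 1 / a * (√(m : ℝ) * frob Θ) + vnorm η) ?_ (by simpa using hα)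
      convert (F.mul_right zero_le_one h1 Θ).add h2 using 1
      funext f f'
      simp only [kword_zero, Matrix.vecMul_one, Pi.add_apply, hρ]
      abel
    | succ n ih =>
      obtain ⟨ih1, ih2⟩ := ih
      let u : (Fin (n + 1) → Fin d) ≃ (Fin n → Fin d) × Fin d :=
        (Fin.snocEquiv fun _ : Fin (n + 1) => Fin d).symm.trans (Equiv.prodComm _ _)
      have hu : ∀ (L : Fin d → Fin d → Matrix (Fin m) (Fin m) ℂ) (f f' : Fin (n + 1) → Fin d),
          kword L f f' = kword L (u f).1 (u f').1 * L (u f).2 (u f').2 := by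
        intro L f f'
        rw [← kword_snoc]
        congr 1 <;> exact (Fin.snoc_init_self _).symm
      constructor
      · convert (ih1.mul_site zero_le_one).reindex zero_le_one u using 1
        funext f f'
        rw [hu, Matrix.vecMul_vecMul]
      -- Telescoping: the new error is error times `K`, plus error times `K' - K`, plus exact word
      -- times `K' - K`. With `x` the old bound, `x + x β + β = (1 + x) (1 + β) - 1`.
      · have h := (((ih2.mul_site (hnn n)).add (hpert (hnn n) ih2)).add
          (hpert zero_le_one ih1)).reindex (by have := hnn n; positivity) u
        refine VBdd.mono (a := (1 + α) * (1 + β) ^ n - 1 + ((1 + α) * (1 + β) ^ n - 1) * β + 1 * β)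
          ?_ (le_of_eq (by ring))
        convert h using 1
        funext f f'
        simp only [Pi.add_apply, hu, ← Matrix.vecMul_vecMul, Matrix.sub_vecMul, Matrix.vecMul_sub]
        abel
  obtain ⟨h1, h2⟩ := hmain t
  have hX : 0 ≤ (1 + α) * (1 + β) ^ t - 1 := by
    have := one_le_mul_of_one_le_of_one_le (by linarith : 1 ≤ 1 + α)
      (one_le_pow₀ (by linarith : 1 ≤ 1 + β) (n := t))
    linarith
  -- The right end: error on `e`, error on `ζ`, and exact word on `ζ`.
  refine FBdd.mono (c := ((1 + α) * (1 + β) ^ t - 1) +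
    (((1 + α) * (1 + β) ^ t - 1) * (vnorm ζ / a) + 1 * (vnorm ζ / a))) ?_ ?_
  · convert (h2.dotProduct_self hX).add
      ((F.dotProduct hX h2 ζ).add (F.dotProduct zero_le_one h1 ζ)) using 1
    ext f f'
    simp only [Matrix.of_apply, Matrix.add_apply, he, Matrix.dotProduct_mulVec, dotProduct_add,
      sub_dotProduct]
    abel
  · nlinarith [mul_le_mul_of_nonneg_left hγ hX]

end NormingFrame

end MatrixProducts

/-! ### Isometries, singular values and pseudoinverses -/

section SingularValues

variable {ι κ μ : Type*} [Fintype ι] [Fintype κ] [Fintype μ]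

theorem vnorm_sq_mulVec (A : Matrix ι κ ℂ) (v : κ → ℂ) :
    ((vnorm (A *ᵥ v) ^ 2 : ℝ) : ℂ) = star v ⬝ᵥ (Aᴴ * A) *ᵥ v := by
  rw [← star_dotProduct_self, Matrix.star_mulVec, ← Matrix.mulVec_mulVec, Matrix.dotProduct_mulVec,
    Matrix.dotProduct_mulVec, Matrix.dotProduct_mulVec]

theorem vnorm_isometry_mulVec [DecidableEq κ] {U : Matrix ι κ ℂ} (hU : Uᴴ * U = 1) (v : κ → ℂ) :
    vnorm (U *ᵥ v) = vnorm v := by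
  have h := vnorm_sq_mulVec U v
  rw [hU, Matrix.one_mulVec, star_dotProduct_self] at h
  exact (sq_eq_sq₀ (vnorm_nonneg _) (vnorm_nonneg _)).mp (Complex.ofReal_injective h)

theorem vnorm_conjTranspose_isometry_mulVec_le [DecidableEq κ] {U : Matrix ι κ ℂ}
    (hU : Uᴴ * U = 1) (y : ι → ℂ) : vnorm (Uᴴ *ᵥ y) ≤ vnorm y := by
  refine vnorm_le_of_norm_dotProduct_le (vnorm_nonneg _) fun u => ?_
  have h : u ᵥ* Uᴴ = star (U *ᵥ star u) := by rw [Matrix.star_mulVec, star_star]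
  rw [Matrix.dotProduct_mulVec, h]
  refine (norm_dotProduct_le _ _).trans_eq ?_
  rw [vnorm_star, vnorm_isometry_mulVec hU, vnorm_star, mul_comm]

theorem frob_conjTranspose_isometry_mul_le [DecidableEq κ] {U : Matrix ι κ ℂ} (hU : Uᴴ * U = 1)
    (N : Matrix ι μ ℂ) : frob (Uᴴ * N) ≤ frob N := by
  refine le_of_sq_le_sq ?_ (frob_nonneg _)
  rw [frob_sq_cols, frob_sq_cols]
  exact Finset.sum_le_sum fun j _ => pow_le_pow_left₀ (vnorm_nonneg _)
    (vnorm_conjTranspose_isometry_mulVec_le hU (Nᵀ j)) 2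

theorem frob_conjTranspose (A : Matrix ι κ ℂ) : frob Aᴴ = frob A := by
  rw [frob_eq_sqrt, frob_eq_sqrt, Finset.sum_comm]
  simp

/-- The first `m` right singular vectors. -/
theorem exists_isometry_sigma_le {p q m : ℕ} (M : Matrix (Fin p) (Fin q) ℂ) (hm : 0 < m)
    (hσ : 0 < sigma m M) : ∃ X : Matrix (Fin q) (Fin m) ℂ, Xᴴ * X = 1 ∧
      ∀ c, sigma m M * vnorm c ≤ vnorm (M *ᵥ X *ᵥ c) := by
  set T := Matrix.toEuclideanLin M with hT
  have hq : Module.finrank ℂ (EuclideanSpace ℂ (Fin q)) = q := finrank_euclideanSpace_fin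
  -- Beyond the dimension of the domain `singularValues` is zero by convention, which positivity of
  -- `sigma m M` excludes.
  have hmq : m ≤ q := by
    by_contra hlt
    have h := T.singularValues_of_finrank_le (i := m - 1) (by rw [hq]; omega)
    rw [sigma, h] at hσ
    exact lt_irrefl _ hσ
  let b := T.isSymmetric_adjoint_comp_self.eigenvectorBasis hq
  let X : Matrix (Fin q) (Fin m) ℂ := Matrix.of fun i j => b (Fin.castLE hmq j) i
  have hsum : ∀ c : Fin m → ℂ, (WithLp.toLp 2 (X *ᵥ c) : EuclideanSpace ℂ (Fin q)) =
      ∑ j, c j • b (Fin.castLE hmq j) := by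
    intro c
    ext i
    simp [X, Matrix.mulVec, dotProduct, mul_comm]
  have hX : Xᴴ * X = 1 := by
    ext i j
    have h := orthonormal_iff_ite.mp b.orthonormal (Fin.castLE hmq i) (Fin.castLE hmq j)
    rw [EuclideanSpace.inner_eq_star_dotProduct, dotProduct_comm] at h
    rw [Matrix.one_apply]
    simpa [X, Matrix.mul_apply, dotProduct] using h
  refine ⟨X, hX, fun c => ?_⟩
  refine le_of_sq_le_sq ?_ (vnorm_nonneg _)
  have h1 : vnorm (M *ᵥ X *ᵥ c) = ‖T (∑ j, c j • b (Fin.castLE hmq j))‖ := by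
    rw [← hsum]; rfl
  have hev : ∀ j : Fin m, (T.adjoint ∘ₗ T) (b (Fin.castLE hmq j)) =
      ((T.singularValues j ^ 2 : ℝ) : ℂ) • b (Fin.castLE hmq j) := by
    intro j
    rw [T.sq_singularValues_of_lt hq (j.2.trans_le hmq)]
    exact T.isSymmetric_adjoint_comp_self.apply_eigenvectorBasis hq _
  have hon : Orthonormal ℂ fun j => b (Fin.castLE hmq j) :=
    b.orthonormal.comp _ (Fin.castLE_injective hmq)
  have h2 : ‖T (∑ j, c j • b (Fin.castLE hmq j))‖ ^ 2 =
      ∑ j : Fin m, T.singularValues j ^ 2 * ‖c j‖ ^ 2 := by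
    have h3 : ((‖T (∑ j, c j • b (Fin.castLE hmq j))‖ ^ 2 : ℝ) : ℂ) =
        ((∑ j : Fin m, T.singularValues j ^ 2 * ‖c j‖ ^ 2 : ℝ) : ℂ) := by
      rw [Complex.ofReal_pow]
      refine (inner_self_eq_norm_sq_to_K (𝕜 := ℂ)
        (T (∑ j, c j • b (Fin.castLE hmq j)))).symm.trans ?_
      rw [← LinearMap.adjoint_inner_right, ← LinearMap.comp_apply, map_sum]
      simp only [map_smul, hev, smul_smul]
      rw [hon.inner_sum]
      push_cast
      refine Finset.sum_congr rfl fun j _ => ?_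
      rw [← mul_assoc, Complex.conj_mul']
      ring
    exact Complex.ofReal_injective h3
  rw [h1, h2, mul_pow, vnorm_sq, Finset.mul_sum]
  refine Finset.sum_le_sum fun j _ => mul_le_mul_of_nonneg_right ?_ (sq_nonneg _)
  exact pow_le_pow_left₀ hσ.le (T.singularValues_antitone (by omega)) 2

theorem IsTruncatedLeftSVD.isometry {p q m : ℕ} {M : Matrix (Fin p) (Fin q) ℂ}
    {U : Matrix (Fin p) (Fin m) ℂ} (hU : IsTruncatedLeftSVD M U) : Uᴴ * U = 1 := by
  obtain ⟨k, hk, W, O, s, hW, hO, hs, hpos, hM, rfl⟩ := hU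
  have h : (W.submatrix id (Fin.castLE hk))ᴴ * W.submatrix id (Fin.castLE hk) =
      (Wᴴ * W).submatrix (Fin.castLE hk) (Fin.castLE hk) := rfl
  rw [h, hW, Matrix.submatrix_one _ (Fin.castLE_injective hk)]

/-- The compression of `M'` to its first `m` left singular vectors is bounded below by
`σ_m(M) - ‖M - M'‖₂`. -/
theorem IsTruncatedLeftSVD.le_vnorm {p q m : ℕ} {M M' : Matrix (Fin p) (Fin q) ℂ}
    {U : Matrix (Fin p) (Fin m) ℂ} (hU : IsTruncatedLeftSVD M' U) (hm : 0 < m)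
    (hσ : 0 < sigma m M) (v : Fin m → ℂ) :
    (sigma m M - frob (M - M')) * vnorm v ≤ vnorm ((Uᴴ * M')ᴴ *ᵥ v) := by
  obtain ⟨X, hX, hXσ⟩ := exists_isometry_sigma_le M hm hσ
  obtain ⟨k, hk, W, O, s, hW, hO, hs, hpos, hM, rfl⟩ := hU
  -- Indices start at zero, so `s l` is the `m`-th singular value of `M'`.
  let l : Fin k := Fin.castLE hk ⟨m - 1, by omega⟩
  have hO' : Oᴴᴴ * Oᴴ = 1 := by rw [Matrix.conjTranspose_conjTranspose, hO]
  have hmin : sigma m M - frob (M - M') ≤ s l := by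
    -- Min-max by dimension count: `m - 1` equations in `m` unknowns have a solution `c ≠ 0`. The
    -- vector `X c` has no component along the first `m - 1` rows of `O`, so `M'` stretches it by at
    -- most `s l`, while `M` stretches it by at least `sigma m M`.
    let R : Matrix (Fin (m - 1)) (Fin m) ℂ :=
      (O * X).submatrix (fun i => Fin.castLE hk (Fin.castLE (by omega) i)) id
    obtain ⟨c, hc0, hc⟩ : ∃ c, c ≠ 0 ∧ R *ᵥ c = 0 := by
      have h := LinearMap.ker_ne_bot_of_finrank_lt (f := R.mulVecLin) (by simp; omega)
      obtain ⟨c, hc, hc0⟩ := Submodule.exists_mem_ne_zero_of_ne_bot h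
      exact ⟨c, hc0, hc⟩
    have hz : ∀ i : Fin k, i < l → (O *ᵥ X *ᵥ c) i = 0 := by
      intro i hi
      have hi' : (i : ℕ) < m - 1 := hi
      have := congrFun hc ⟨i, hi'⟩
      rw [Matrix.mulVec_mulVec]
      exact this
    have h1 : vnorm (M' *ᵥ X *ᵥ c) ≤ s l * vnorm c := by
      rw [hM, ← Matrix.mulVec_mulVec, ← Matrix.mulVec_mulVec, vnorm_isometry_mulVec hW]
      have h2 : vnorm (Matrix.diagonal (fun i => (s i : ℂ)) *ᵥ (O *ᵥ X *ᵥ c)) ≤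
          s l * vnorm (O *ᵥ X *ᵥ c) := by
        refine le_of_sq_le_sq ?_ (mul_nonneg (hpos l).le (vnorm_nonneg _))
        rw [mul_pow, vnorm_sq, vnorm_sq, Finset.mul_sum]
        refine Finset.sum_le_sum fun i _ => ?_
        rw [Matrix.mulVec_diagonal]
        rcases lt_or_ge i l with hi | hi
        · simp [hz i hi]
        · rw [norm_mul, mul_pow, Complex.norm_real, Real.norm_of_nonneg (hpos i).le]
          exact mul_le_mul_of_nonneg_right (pow_le_pow_left₀ (hpos i).le (hs hi) 2) (sq_nonneg _)
      refine h2.trans (mul_le_mul_of_nonneg_left ?_ (hpos l).le)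
      have h3 := vnorm_conjTranspose_isometry_mulVec_le hO' (X *ᵥ c)
      rw [Matrix.conjTranspose_conjTranspose] at h3
      exact h3.trans_eq (vnorm_isometry_mulVec hX c)
    have h4 := vnorm_sub_le (M *ᵥ X *ᵥ c) (M' *ᵥ X *ᵥ c)
    rw [← Matrix.sub_mulVec] at h4
    have h5 := vnorm_mulVec_le_frob (M - M') (X *ᵥ c)
    rw [vnorm_isometry_mulVec hX] at h5
    have h6 := hXσ c
    refine le_of_mul_le_mul_right ?_ (vnorm_pos hc0)
    linarith
  refine (mul_le_mul_of_nonneg_right hmin (vnorm_nonneg v)).trans ?_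
  -- The compressed adjoint pads `v` by zeros, scales the first `m` coordinates by singular values
  -- that are at least `s l`, and applies an isometry.
  have e : ((W.submatrix id (Fin.castLE hk))ᴴ * M')ᴴ *ᵥ v =
      Oᴴ *ᵥ (Matrix.diagonal (fun i => (s i : ℂ)) *ᵥ
        ((1 : Matrix (Fin k) (Fin k) ℂ).submatrix id (Fin.castLE hk) *ᵥ v)) := by
    have h : (1 : Matrix (Fin k) (Fin k) ℂ).submatrix id (Fin.castLE hk) =
        Wᴴ * W.submatrix id (Fin.castLE hk) := by
      rw [← hW]; rfl
    rw [h, hM]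
    simp only [Matrix.conjTranspose_mul, Matrix.conjTranspose_conjTranspose,
      Matrix.diagonal_conjTranspose, Matrix.mulVec_mulVec, Matrix.mul_assoc]
    congr 4
    ext i
    simp
  rw [e, vnorm_isometry_mulVec hO']
  refine le_of_sq_le_sq ?_ (vnorm_nonneg _)
  rw [mul_pow, vnorm_sq, vnorm_sq, Finset.mul_sum]
  have h7 : ∀ j : Fin m, (((1 : Matrix (Fin k) (Fin k) ℂ).submatrix id (Fin.castLE hk)) *ᵥ v)
      (Fin.castLE hk j) = v j := by
    intro j
    simp [Matrix.mulVec, dotProduct, Matrix.one_apply, (Fin.castLE_injective hk).eq_iff]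
  calc _ ≤ ∑ j : Fin m, ‖(Matrix.diagonal (fun i => (s i : ℂ)) *ᵥ
        ((1 : Matrix (Fin k) (Fin k) ℂ).submatrix id (Fin.castLE hk) *ᵥ v)) (Fin.castLE hk j)‖ ^ 2 := by
        refine Finset.sum_le_sum fun j _ => ?_
        rw [Matrix.mulVec_diagonal, h7, norm_mul, mul_pow, Complex.norm_real,
          Real.norm_of_nonneg (hpos _).le]
        refine mul_le_mul_of_nonneg_right (pow_le_pow_left₀ (hpos l).le (hs ?_) 2) (sq_nonneg _)
        change (j : ℕ) ≤ m - 1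
        omega
    _ ≤ _ := by
        rw [← Finset.sum_image (s := Finset.univ) (g := Fin.castLE hk)
          (f := fun i => ‖(Matrix.diagonal (fun i => (s i : ℂ)) *ᵥ
            ((1 : Matrix (Fin k) (Fin k) ℂ).submatrix id (Fin.castLE hk) *ᵥ v)) i‖ ^ 2)
          (fun _ _ _ _ h => Fin.castLE_injective hk h)]
        exact Finset.sum_le_sum_of_subset_of_nonneg (Finset.subset_univ _)
          fun _ _ _ => sq_nonneg _

variable {m q : ℕ} {M : Matrix (Fin m) (Fin q) ℂ} {a : ℝ}

/-- The solution is `x = Mᴴ u` with `M Mᴴ u = v`, solvable since `M Mᴴ` is injective. Its norm obeys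
`‖Mᴴ u‖² = ⟨u, v⟩ ≤ ‖u‖ ‖v‖ ≤ ‖Mᴴ u‖ ‖v‖ / a`. -/
theorem exists_mulVec_eq_of_le_vnorm (ha : 0 < a) (h : ∀ v, a * vnorm v ≤ vnorm (Mᴴ *ᵥ v))
    (v : Fin m → ℂ) : ∃ x, M *ᵥ x = v ∧ vnorm x ≤ vnorm v / a := by
  have hsq : ∀ u, ((vnorm (Mᴴ *ᵥ u) ^ 2 : ℝ) : ℂ) = star u ⬝ᵥ (M * Mᴴ) *ᵥ u := fun u => by
    rw [vnorm_sq_mulVec, Matrix.conjTranspose_conjTranspose]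
  have hinj : Function.Injective (M * Mᴴ).mulVecLin := by
    rw [← LinearMap.ker_eq_bot, LinearMap.ker_eq_bot']
    intro u hu
    have h1 := hsq u
    rw [Matrix.mulVecLin_apply] at hu
    rw [hu, dotProduct_zero] at h1
    have h2 : vnorm (Mᴴ *ᵥ u) ^ 2 = 0 := Complex.ofReal_injective h1
    have h3 := h u
    rw [pow_eq_zero_iff two_ne_zero] at h2
    rw [h2] at h3
    exact vnorm_eq_zero (le_antisymm (by nlinarith [vnorm_nonneg u]) (vnorm_nonneg u))
  obtain ⟨u, hu⟩ := LinearMap.injective_iff_surjective.mp hinj v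
  rw [Matrix.mulVecLin_apply] at hu
  refine ⟨Mᴴ *ᵥ u, by rw [Matrix.mulVec_mulVec, hu], ?_⟩
  have h1 := hsq u
  rw [hu] at h1
  have h2 : vnorm (Mᴴ *ᵥ u) ^ 2 ≤ vnorm u * vnorm v := by
    have := norm_dotProduct_le (star u) v
    rwa [← h1, vnorm_star, Complex.norm_real, Real.norm_of_nonneg (sq_nonneg _)] at this
  rw [le_div_iff₀ ha]
  have h3 := h u
  rcases (vnorm_nonneg (Mᴴ *ᵥ u)).eq_or_lt with h0 | h0
  · rw [← h0]; simpa using vnorm_nonneg v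
  · refine le_of_mul_le_mul_left ?_ h0
    nlinarith [mul_le_mul_of_nonneg_right h3 (vnorm_nonneg v), vnorm_nonneg v]

/-- The lower bound makes `M` surjective, and `M M⁺` fixes the range of `M`. -/
theorem mul_pinv_eq_one (ha : 0 < a) (h : ∀ v, a * vnorm v ≤ vnorm (Mᴴ *ᵥ v)) :
    M * pinv M = 1 := by
  refine Matrix.ext_of_mulVec_single fun i => ?_
  obtain ⟨x, hx, -⟩ := exists_mulVec_eq_of_le_vnorm ha h (Pi.single i 1)
  rw [← hx, Matrix.mulVec_mulVec, (isMoorePenrose_pinv M).mul_mul_self, Matrix.one_mulVec]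

/-- `Mᴴ (M⁺)ᴴ = (M⁺ M)ᴴ` is an orthogonal projection, hence a contraction; the lower bound is
applied to `(M⁺)ᴴ` acting on the conjugate of `y`. -/
theorem vnorm_vecMul_pinv_le (ha : 0 < a) (h : ∀ v, a * vnorm v ≤ vnorm (Mᴴ *ᵥ v))
    (y : Fin q → ℂ) : vnorm (y ᵥ* pinv M) ≤ vnorm y / a := by
  have hP := isMoorePenrose_pinv M
  set Q := pinv M * M with hQ
  have hQH : Qᴴ = Q := hP.isHermitian_right
  have hQQ : Qᴴ * Q = Q := by
    rw [hQH, hQ, ← Matrix.mul_assoc, hP.self_mul_mul]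
  have hproj : ∀ z, vnorm (Q *ᵥ z) ≤ vnorm z := by
    intro z
    have h1 := vnorm_sq_mulVec Q z
    rw [hQQ] at h1
    have h2 := norm_dotProduct_le (star z) (Q *ᵥ z)
    rw [← h1, vnorm_star, Complex.norm_real, Real.norm_of_nonneg (sq_nonneg _)] at h2
    rcases (vnorm_nonneg (Q *ᵥ z)).eq_or_lt with h0 | h0
    · rw [← h0]; exact vnorm_nonneg z
    · exact le_of_mul_le_mul_right (by nlinarith) h0
  have e : y ᵥ* pinv M = star ((pinv M)ᴴ *ᵥ star y) := by
    rw [Matrix.star_mulVec, star_star, Matrix.conjTranspose_conjTranspose]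
  have h1 := h ((pinv M)ᴴ *ᵥ star y)
  rw [Matrix.mulVec_mulVec, ← Matrix.conjTranspose_mul, ← hQ, hQH] at h1
  have h2 := hproj (star y)
  rw [vnorm_star] at h2
  rw [e, vnorm_star, le_div_iff₀ ha, mul_comm]
  exact h1.trans h2

theorem frob_mul_pinv_le (ha : 0 < a) (h : ∀ v, a * vnorm v ≤ vnorm (Mᴴ *ᵥ v))
    (N : Matrix ι (Fin q) ℂ) : frob (N * pinv M) ≤ frob N / a := by
  refine le_of_sq_le_sq ?_ (div_nonneg (frob_nonneg _) ha.le)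
  rw [div_pow, frob_sq_rows, frob_sq_rows, Finset.sum_div]
  refine Finset.sum_le_sum fun i _ => ?_
  rw [← div_pow]
  exact pow_le_pow_left₀ (vnorm_nonneg _) (vnorm_vecMul_pinv_le ha h (N i)) 2

end SingularValues

/-! ### Elementary tensors -/

section Elem

variable {d n : ℕ}

theorem elem_mul (A B : Fin n → Matrix (Fin d) (Fin d) ℂ) :
    elem A * elem B = elem fun i => A i * B i := by
  ext f g
  simp only [elem, Matrix.mul_apply, Matrix.of_apply, ← Finset.prod_mul_distrib,
    Finset.prod_univ_sum, Fintype.piFinset_univ]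

theorem trace_elem (A : Fin n → Matrix (Fin d) (Fin d) ℂ) :
    (elem A).trace = ∏ i, (A i).trace := by
  simp only [Matrix.trace, Matrix.diag_apply, elem, Matrix.of_apply, Finset.prod_univ_sum,
    Fintype.piFinset_univ]

theorem star_elem (A : Fin n → Matrix (Fin d) (Fin d) ℂ) :
    star (elem A) = elem fun i => star (A i) := by
  ext f g
  simp [elem, Matrix.star_apply]

variable {𝒜 : StarSubalgebra ℂ (Matrix (Fin d) (Fin d) ℂ)}

/-- The linear span of elementary tensors is already a unital `*`-algebra, so generating adds
nothing. Functionals can thus be compared on elementary tensors. -/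
theorem mem_span_elem {X : Matrix (Fin n → Fin d) (Fin n → Fin d) ℂ} (hX : X ∈ chainAlg 𝒜 n) :
    X ∈ Submodule.span ℂ (Set.range fun A : Fin n → 𝒜 =>
      elem fun i => (A i : Matrix (Fin d) (Fin d) ℂ)) := by
  have hone : (1 : Matrix (Fin n → Fin d) (Fin n → Fin d) ℂ) ∈ Submodule.span ℂ
      (Set.range fun A : Fin n → 𝒜 => elem fun i => (A i : Matrix (Fin d) (Fin d) ℂ)) :=
    Submodule.subset_span ⟨fun _ => 1, elem_one n⟩
  induction hX using StarAlgebra.adjoin_induction with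
  | mem x hx => obtain ⟨A, rfl⟩ := hx; exact Submodule.subset_span ⟨A, rfl⟩
  | algebraMap c => rw [Algebra.algebraMap_eq_smul_one]; exact Submodule.smul_mem _ _ hone
  | add x y _ _ hx hy => exact add_mem hx hy
  | mul x y _ _ hx hy =>
    have h := Submodule.mul_mem_mul hx hy
    rw [Submodule.span_mul_span] at h
    refine Submodule.span_mono ?_ h
    rintro _ ⟨_, ⟨A, rfl⟩, _, ⟨B, rfl⟩, rfl⟩
    exact ⟨fun i => A i * B i, (elem_mul _ _).symm⟩
  | star x hx' hx =>
    clear hx'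
    induction hx using Submodule.span_induction with
    | mem x hx =>
      obtain ⟨A, rfl⟩ := hx
      exact Submodule.subset_span ⟨fun i => star (A i), (star_elem _).symm⟩
    | zero => rw [star_zero]; exact zero_mem _
    | add x y _ _ hx hy => rw [star_add]; exact add_mem hx hy
    | smul c x _ hx => rw [star_smul]; exact Submodule.smul_mem _ _ hx

theorem chainAlg_linearMap_ext {f g : chainAlg 𝒜 n →ₗ[ℂ] ℂ}
    (h : ∀ A : Fin n → 𝒜, f ⟨elem fun i => (A i : Matrix (Fin d) (Fin d) ℂ), elem_mem A⟩ =
      g ⟨elem fun i => (A i : Matrix (Fin d) (Fin d) ℂ), elem_mem A⟩) : f = g := by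
  ext ⟨X, hX⟩
  obtain ⟨c, hc⟩ := Finsupp.mem_span_range_iff_exists_finsupp.mp (mem_span_elem hX)
  have e : (⟨X, hX⟩ : chainAlg 𝒜 n) =
      c.sum fun A z => z • ⟨elem fun i => (A i : Matrix (Fin d) (Fin d) ℂ), elem_mem A⟩ := by
    apply Subtype.ext
    rw [Finsupp.sum, AddSubmonoidClass.coe_finsetSum]
    exact hc.symm
  rw [e, Finsupp.sum, map_sum, map_sum]
  exact Finset.sum_congr rfl fun A _ => by rw [map_smul, map_smul, h]

end Elem

/-! ### Orthonormal bases of matrix algebras -/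

namespace HSBasis

variable {N : Type*} [Fintype N] [DecidableEq N] {S : StarSubalgebra ℂ (Matrix N N ℂ)} {k : ℕ}
  (Z : HSBasis S k)

include Z

theorem coe_eq_sum_repr (B : S) :
    (B : Matrix N N ℂ) = ∑ i, Z.basis.repr B i • (Z.basis i : Matrix N N ℂ) := by
  conv_lhs => rw [← Z.basis.sum_repr B]
  rw [AddSubmonoidClass.coe_finsetSum]
  rfl

theorem trace_mul_eq_repr (B : S) (j : Fin k) :
    ((Z.basis j : Matrix N N ℂ) * (B : Matrix N N ℂ)).trace = Z.basis.repr B j := by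
  rw [Z.coe_eq_sum_repr B, Matrix.mul_sum, Matrix.trace_sum]
  simp [Z.trace_mul]

theorem sum_trace_smul (B : S) :
    ∑ j, ((Z.basis j : Matrix N N ℂ) * (B : Matrix N N ℂ)).trace • Z.basis j = B := by
  simp only [Z.trace_mul_eq_repr, Z.basis.sum_repr]

/-- Parseval: self-adjointness of the basis turns the bilinear trace relations into Hilbert–Schmidt
orthonormality. -/
theorem frob_sum_smul (c : Fin k → ℂ) :
    frob (∑ j, c j • (Z.basis j : Matrix N N ℂ)) = vnorm c := by
  refine (sq_eq_sq₀ (frob_nonneg _) (vnorm_nonneg _)).mp (Complex.ofReal_injective ?_)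
  have h1 : ∀ A : Matrix N N ℂ, ((frob A ^ 2 : ℝ) : ℂ) = (Aᴴ * A).trace := by
    intro A
    rw [frob_sq_cols, Complex.ofReal_sum]
    exact Finset.sum_congr rfl fun j _ => (star_dotProduct_self _).symm
  rw [h1, vnorm_sq, Matrix.conjTranspose_sum, Matrix.sum_mul, Matrix.trace_sum]
  push_cast
  refine Finset.sum_congr rfl fun i _ => ?_
  rw [Matrix.mul_sum, Matrix.trace_sum]
  simp only [Matrix.conjTranspose_smul, (Z.isHermitian _).eq, Matrix.smul_mul, Matrix.mul_smul,
    Matrix.trace_smul, Z.trace_mul, smul_eq_mul]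
  rw [Finset.sum_eq_single i (fun b _ hb => by simp [hb.symm]) (by simp)]
  rw [if_pos rfl, mul_one, ← Complex.conj_mul']
  exact mul_comm _ _

end HSBasis

/-! ### Positive functionals on matrix algebras -/

section Positive

variable {N : Type*} [Fintype N] [DecidableEq N] {S : StarSubalgebra ℂ (Matrix N N ℂ)}

/-- The functional is real on self-adjoint `Y`, by `4 Y = (1 + Y)² - (1 - Y)²`. Applied to `H = i (D
- D*)`, which lies in `S`, this gives `Tr[H²] = i (Tr[D H] - Tr[D* H]) = 0`. -/
theorem isHermitian_of_trace_nonneg {D : Matrix N N ℂ} (hD : D ∈ S)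
    (h : ∀ Y ∈ S, 0 ≤ (D * (star Y * Y)).trace) : D.IsHermitian := by
  have hreal : ∀ Y ∈ S, Y.IsHermitian → star (D * Y).trace = (D * Y).trace := by
    intro Y hY hYh
    have hst : star Y = Y := hYh
    have h1 := h (1 + Y) (add_mem (one_mem S) hY)
    have h2 := h (1 - Y) (sub_mem (one_mem S) hY)
    have e : (D * Y).trace = 4⁻¹ * ((D * (star (1 + Y) * (1 + Y))).trace -
        (D * (star (1 - Y) * (1 - Y))).trace) := by
      rw [star_add, star_sub, star_one, hst, ← Matrix.trace_sub, ← Matrix.mul_sub]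
      have e1 : (1 + Y) * (1 + Y) - (1 - Y) * (1 - Y) = (4 : ℂ) • Y := by
        have : (1 + Y) * (1 + Y) - (1 - Y) * (1 - Y) = Y + Y + Y + Y := by noncomm_ring
        rw [this, show (4 : ℂ) = 1 + 1 + 1 + 1 by norm_num]
        simp only [add_smul, one_smul]
      rw [e1, Matrix.mul_smul, Matrix.trace_smul, smul_eq_mul, ← mul_assoc]
      norm_num
    have s1 := (IsSelfAdjoint.of_nonneg h1).star_eq
    have s2 := (IsSelfAdjoint.of_nonneg h2).star_eq
    rw [e, star_mul', star_sub, s1, s2]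
    simp
  set H : Matrix N N ℂ := Complex.I • (D - star D) with hH
  have hHS : H ∈ S := SMulMemClass.smul_mem _ (sub_mem hD (star_mem hD))
  have hHh : star H = H := by
    rw [hH, star_smul, star_sub, star_star, Complex.star_def, Complex.conj_I, neg_smul, ← smul_neg,
      neg_sub]
  have h1 := hreal H hHS hHh
  have h2 : (star D * H).trace = star (D * H).trace := by
    rw [← Matrix.trace_conjTranspose, Matrix.conjTranspose_mul, Matrix.trace_mul_comm]
    congr 2
    exact hHh.symm
  have h3 : (Hᴴ * H).trace = 0 := by
    change (star H * H).trace = 0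
    rw [hHh]
    conv_lhs => rw [hH]
    rw [← hH, Matrix.smul_mul, Matrix.trace_smul, Matrix.sub_mul, Matrix.trace_sub, h2, h1,
      sub_self, smul_zero]
  have h4 : H = 0 := Matrix.trace_conjTranspose_mul_self_eq_zero_iff.mp h3
  rw [hH, smul_eq_zero_iff_right Complex.I_ne_zero, sub_eq_zero] at h4
  exact h4.symm

/-- The density matrix in `S` of a positive functional on `S` is positive semidefinite. -/
theorem posSemidef_of_trace_nonneg {D : Matrix N N ℂ} (hD : D ∈ S)
    (h : ∀ Y ∈ S, 0 ≤ (D * (star Y * Y)).trace) : D.PosSemidef := by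
  open scoped MatrixOrder in
  have hDh : IsSelfAdjoint D := isHermitian_of_trace_nonneg hD h
  have : IsClosed (S : Set (Matrix N N ℂ)) :=
    Submodule.closed_of_finiteDimensional S.toSubalgebra.toSubmodule
  -- The test element is the square root of the negative part `M` of `D`, which stays in `S` by
  -- functional calculus. Then `Tr[D Y²] = -Tr[M²]`, so positivity forces `M = 0`.
  set Y : Matrix N N ℂ := cfc (fun x : ℝ => √(max (-x) 0)) D with hY
  set M : Matrix N N ℂ := cfc (fun x : ℝ => max (-x) 0) D with hM
  have hYS : Y ∈ S := cfc_mem _ hD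
  have hYh : star Y = Y := (cfc_predicate (fun x : ℝ => √(max (-x) 0)) D).star_eq
  have hMh : star M = M := (cfc_predicate (fun x : ℝ => max (-x) 0) D).star_eq
  have hYY : star Y * Y = M := by
    rw [hYh, hY, ← cfc_mul (fun x : ℝ => √(max (-x) 0)) (fun x : ℝ => √(max (-x) 0)) D, hM]
    exact cfc_congr fun x _ => Real.mul_self_sqrt (le_max_right _ _)
  have hDM : D * M = -(star M * M) := by
    rw [hMh]
    conv_lhs => rw [← cfc_id' ℝ D]
    rw [hM, ← cfc_mul (fun x : ℝ => x) (fun x : ℝ => max (-x) 0) D,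
      ← cfc_mul (fun x : ℝ => max (-x) 0) (fun x : ℝ => max (-x) 0) D, ← cfc_neg]
    refine cfc_congr fun x _ => ?_
    rcases le_total (-x) 0 with hx | hx
    · simp [max_eq_right hx]
    · simp [max_eq_left hx]
  have h1 := h Y hYS
  rw [hYY, hDM, Matrix.trace_neg] at h1
  have h2 : 0 ≤ (star M * M).trace := (Matrix.posSemidef_conjTranspose_mul_self M).trace_nonneg
  have h3 : M = 0 := Matrix.trace_conjTranspose_mul_self_eq_zero_iff.mp
    (le_antisymm (neg_nonneg.mp h1) h2)
  have h4 : D = cfc (fun x : ℝ => max x 0) D := by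
    have h5 : D + M = cfc (fun x : ℝ => max x 0) D := by
      have h6 : cfc (fun x : ℝ => x + max (-x) 0) D = D + M := by
        rw [cfc_add D (fun x : ℝ => x) (fun x : ℝ => max (-x) 0), cfc_id' ℝ D]
      rw [← h6]
      refine cfc_congr fun x _ => ?_
      rcases le_total (-x) 0 with hx | hx
      · simp [neg_nonpos.mp hx]
      · simp [neg_nonneg.mp hx]
    rwa [h3, add_zero] at h5
  rw [h4]
  exact Matrix.nonneg_iff_posSemidef.mp (cfc_nonneg fun x _ => le_max_right _ _)

end Positive

/-! ### Evaluation of matrix products on observables -/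

section Evaluation

variable {d m k : ℕ}

/-- The map `A₁ ⊗ ⋯ ⊗ Aₙ ↦ K_{A₁} ⋯ K_{Aₙ}` on the full matrix algebra. -/
def evalWord (K : Fin d → Fin d → Matrix (Fin m) (Fin m) ℂ) (n : ℕ) :
    Matrix (Fin n → Fin d) (Fin n → Fin d) ℂ →ₗ[ℂ] Matrix (Fin m) (Fin m) ℂ where
  toFun X := ∑ f, ∑ g, X f g • kword K f g
  map_add' X X' := by simp [add_smul, Finset.sum_add_distrib]
  map_smul' c X := by simp [Finset.smul_sum, smul_smul]

theorem evalWord_apply (K : Fin d → Fin d → Matrix (Fin m) (Fin m) ℂ) {n : ℕ}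
    (X : Matrix (Fin n → Fin d) (Fin n → Fin d) ℂ) :
    evalWord K n X = ∑ f, ∑ g, X f g • kword K f g := rfl

theorem dotProduct_evalWord_mulVec (K : Fin d → Fin d → Matrix (Fin m) (Fin m) ℂ) {n : ℕ}
    (X : Matrix (Fin n → Fin d) (Fin n → Fin d) ℂ) (u v : Fin m → ℂ) :
    u ⬝ᵥ (evalWord K n X *ᵥ v) = ∑ f, ∑ g, X f g * (u ⬝ᵥ (kword K f g *ᵥ v)) := by
  simp [evalWord_apply, Matrix.sum_mulVec, dotProduct_sum, Matrix.smul_mulVec]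

theorem evalWord_tens (K : Fin d → Fin d → Matrix (Fin m) (Fin m) ℂ) {a b : ℕ}
    (Y : Matrix (Fin a → Fin d) (Fin a → Fin d) ℂ)
    (X : Matrix (Fin b → Fin d) (Fin b → Fin d) ℂ) :
    evalWord K (a + b) (tens Y X) = evalWord K a Y * evalWord K b X := by
  rw [evalWord_apply, ← (Fin.appendEquiv a b).sum_comp, Fintype.sum_prod_type]
  simp only [evalWord_apply, Finset.sum_mul_sum]
  refine Finset.sum_congr rfl fun f _ => Finset.sum_congr rfl fun f' _ => ?_
  rw [← (Fin.appendEquiv a b).sum_comp, Fintype.sum_prod_type]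
  refine Finset.sum_congr rfl fun g _ => Finset.sum_congr rfl fun g' _ => ?_
  have h := kword_append K f g f' g'
  change tens Y X (Fin.append f f') (Fin.append g g') •
    kword K (Fin.append f f') (Fin.append g g') = _
  rw [h, smul_mul_smul_comm]
  simp [tens]

variable {𝒜 : StarSubalgebra ℂ (Matrix (Fin d) (Fin d) ℂ)} (Z : HSBasis 𝒜 k)

/-- The coefficients `F(P(E_{ab}))` of the extension of `F` to `M_d(ℂ)` along the
trace-orthogonal projection `P` onto `𝒜`. -/
def siteCoeff (F : 𝒜 →ₗ[ℂ] Matrix (Fin m) (Fin m) ℂ) (a b : Fin d) : Matrix (Fin m) (Fin m) ℂ :=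
  -- The indices are swapped because `Tr[Z_j E_{ab}] = (Z_j)_{ba}`.
  ∑ j, (Z.basis j : Matrix (Fin d) (Fin d) ℂ) b a • F (Z.basis j)

theorem kword_siteCoeff (F : 𝒜 →ₗ[ℂ] Matrix (Fin m) (Fin m) ℂ) {n : ℕ} (f g : Fin n → Fin d) :
    kword (siteCoeff Z F) f g = ∑ κ : Fin n → Fin k,
      elem (fun i => (Z.basis (κ i) : Matrix (Fin d) (Fin d) ℂ)) g f •
        (List.ofFn fun i => F (Z.basis (κ i))).prod := by
  have h : kword (siteCoeff Z F) f g = MultilinearMap.mkPiAlgebraFin ℂ n (Matrix (Fin m) (Fin m) ℂ)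
      fun i => ∑ j, (Z.basis j : Matrix (Fin d) (Fin d) ℂ) (g i) (f i) • F (Z.basis j) := by
    rw [MultilinearMap.mkPiAlgebraFin_apply]; rfl
  rw [h, MultilinearMap.map_sum]
  refine Finset.sum_congr rfl fun κ _ => ?_
  rw [MultilinearMap.map_smul_univ, MultilinearMap.mkPiAlgebraFin_apply]
  rfl

theorem evalWord_siteCoeff (F : 𝒜 →ₗ[ℂ] Matrix (Fin m) (Fin m) ℂ) {n : ℕ}
    (X : Matrix (Fin n → Fin d) (Fin n → Fin d) ℂ) :
    evalWord (siteCoeff Z F) n X = ∑ κ : Fin n → Fin k,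
      (elem (fun i => (Z.basis (κ i) : Matrix (Fin d) (Fin d) ℂ)) * X).trace •
        (List.ofFn fun i => F (Z.basis (κ i))).prod := by
  simp only [evalWord_apply, kword_siteCoeff, Finset.smul_sum, smul_smul, Matrix.trace,
    Matrix.diag_apply, Matrix.mul_apply, Finset.sum_smul]
  rw [Finset.sum_comm]
  refine (Finset.sum_congr rfl fun g _ => Finset.sum_comm).trans ?_
  rw [Finset.sum_comm]
  exact Finset.sum_congr rfl fun κ _ => Finset.sum_congr rfl fun g _ =>
    Finset.sum_congr rfl fun f _ => by rw [mul_comm]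

/-- The projection onto `𝒜` fixes every `A i`; the identity follows by expanding both sides in the
product basis. -/
theorem evalWord_siteCoeff_elem (F : 𝒜 →ₗ[ℂ] Matrix (Fin m) (Fin m) ℂ) {n : ℕ} (A : Fin n → 𝒜) :
    evalWord (siteCoeff Z F) n (elem fun i => (A i : Matrix (Fin d) (Fin d) ℂ)) =
      (List.ofFn fun i => F (A i)).prod := by
  have h : (List.ofFn fun i => F (A i)).prod =
      ((MultilinearMap.mkPiAlgebraFin ℂ n (Matrix (Fin m) (Fin m) ℂ)).compLinearMap fun _ => F)
        fun i => ∑ j, ((Z.basis j : Matrix (Fin d) (Fin d) ℂ) *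
          (A i : Matrix (Fin d) (Fin d) ℂ)).trace • Z.basis j := by
    simp only [Z.sum_trace_smul, MultilinearMap.compLinearMap_apply,
      MultilinearMap.mkPiAlgebraFin_apply]
  rw [h, MultilinearMap.map_sum, evalWord_siteCoeff]
  refine Finset.sum_congr rfl fun κ _ => ?_
  rw [MultilinearMap.map_smul_univ, elem_mul, trace_elem]
  simp only [MultilinearMap.compLinearMap_apply, MultilinearMap.mkPiAlgebraFin_apply]

theorem evalWord_siteCoeff_site (F : 𝒜 →ₗ[ℂ] Matrix (Fin m) (Fin m) ℂ) (A : 𝒜) :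
    evalWord (siteCoeff Z F) 1 (elem fun _ : Fin 1 => (A : Matrix (Fin d) (Fin d) ℂ)) = F A := by
  rw [evalWord_siteCoeff_elem Z F fun _ : Fin 1 => A]
  simp

theorem evalWord_siteCoeff_one (F : 𝒜 →ₗ[ℂ] Matrix (Fin m) (Fin m) ℂ) (n : ℕ) :
    evalWord (siteCoeff Z F) n 1 = F 1 ^ n := by
  rw [← elem_one n]
  exact (evalWord_siteCoeff_elem Z F fun _ => 1).trans (by simp)

/-- Parseval for each memory entry `(x, y)` separately: up to transposition, the coefficients form
the matrix `∑ j, F(Z_j)_{xy} Z_j`. Hence passing from `𝒜` to `M_d` does not change the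
Hilbert–Schmidt norm. -/
theorem sum_frob_siteCoeff (F : 𝒜 →ₗ[ℂ] Matrix (Fin m) (Fin m) ℂ) :
    ∑ a, ∑ b, frob (siteCoeff Z F a b) ^ 2 = ∑ j, frob (F (Z.basis j)) ^ 2 := by
  have h : ∀ x y, ∑ a, ∑ b, ‖siteCoeff Z F a b x y‖ ^ 2 = ∑ j, ‖F (Z.basis j) x y‖ ^ 2 := by
    intro x y
    have h1 := congrArg (· ^ 2) (Z.frob_sum_smul fun j => F (Z.basis j) x y)
    simp only [frob_sq, vnorm_sq] at h1
    rw [← h1, Finset.sum_comm]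
    refine Finset.sum_congr rfl fun b _ => Finset.sum_congr rfl fun a _ => ?_
    congr 2
    simp [siteCoeff, Matrix.sum_apply, mul_comm]
  simp only [frob_sq]
  rw [sum_comm_pairs, Finset.sum_comm (γ := Fin k)]
  refine Finset.sum_congr rfl fun x _ => ?_
  rw [Finset.sum_comm (γ := Fin k)]
  exact Finset.sum_congr rfl fun y _ => h x y

end Evaluation

/-! ### Realizations by matrices -/

/-- A realization on `ℂᵐ`, written with matrices. -/
structure MatrixRealization {d : ℕ} {𝒜 : StarSubalgebra ℂ (Matrix (Fin d) (Fin d) ℂ)}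
    (ω : ChainState 𝒜) (m : ℕ) where
  F : 𝒜 →ₗ[ℂ] Matrix (Fin m) (Fin m) ℂ
  ρ : Fin m → ℂ
  e : Fin m → ℂ
  generates : ∀ n (A : Fin n → 𝒜),
    ω.marginal n ⟨elem fun i => (A i : Matrix (Fin d) (Fin d) ℂ), elem_mem A⟩ =
      ρ ⬝ᵥ ((List.ofFn fun i => F (A i)).prod *ᵥ e)
  ρ_one : ρ ᵥ* F 1 = ρ
  one_e : F 1 *ᵥ e = e

section Realizations

variable {d m : ℕ} {𝒜 : StarSubalgebra ℂ (Matrix (Fin d) (Fin d) ℂ)} {ω : ChainState 𝒜}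

/-- The matrices of a realization in the standard basis. -/
def Realization.toMatrixRealization (R : Realization ω (Fin m → ℂ)) : MatrixRealization ω m where
  F := (LinearMap.toMatrixAlgEquiv' (R := ℂ) (n := Fin m)).toLinearMap ∘ₗ R.E
  ρ := fun i => R.ρ (Pi.single i 1)
  e := R.e
  generates n A := by
    have hρ : ∀ v, R.ρ v = (fun i => R.ρ (Pi.single i 1)) ⬝ᵥ v := fun v => by
      conv_lhs => rw [pi_eq_sum_univ' v, map_sum]
      simp [dotProduct, mul_comm]
    rw [R.generates, hρ]
    congr 1
    have h : (List.ofFn fun i => ((LinearMap.toMatrixAlgEquiv' (R := ℂ) (n := Fin m)).toLinearMap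
        ∘ₗ R.E) (A i)).prod =
        LinearMap.toMatrixAlgEquiv' (List.ofFn fun i => R.E (A i)).prod := by
      rw [map_list_prod, List.map_ofFn]
      rfl
    rw [h]
    exact (LinearMap.toMatrix'_mulVec _ _).symm
  ρ_one := by
    have hρ : ∀ v, R.ρ v = (fun i => R.ρ (Pi.single i 1)) ⬝ᵥ v := fun v => by
      conv_lhs => rw [pi_eq_sum_univ' v, map_sum]
      simp [dotProduct, mul_comm]
    funext j
    exact (hρ _).symm.trans (LinearMap.congr_fun R.ρ_E_one (Pi.single j 1))
  one_e := by
    exact (LinearMap.toMatrix'_mulVec _ _).trans R.E_one_e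

theorem prod_map_conj {J J' : Matrix (Fin m) (Fin m) ℂ} (h : J' * J = 1) (h' : J * J' = 1)
    (L : List (Matrix (Fin m) (Fin m) ℂ)) :
    (L.map fun B => J * B * J').prod = J * L.prod * J' := by
  induction L with
  | nil => simpa using h'.symm
  | cons B L ih =>
    rw [List.map_cons, List.prod_cons, List.prod_cons, ih]
    calc _ = J * B * (J' * J) * L.prod * J' := by simp only [Matrix.mul_assoc]
      _ = _ := by rw [h, Matrix.mul_one, Matrix.mul_assoc J B]

/-- Change of basis in a realization. -/
def MatrixRealization.conj (R : MatrixRealization ω m) (J J' : Matrix (Fin m) (Fin m) ℂ)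
    (h : J' * J = 1) (h' : J * J' = 1) : MatrixRealization ω m where
  F :=
    { toFun := fun A => J * R.F A * J'
      map_add' := fun A B => by simp [Matrix.mul_add, Matrix.add_mul]
      map_smul' := fun c A => by simp }
  ρ := R.ρ ᵥ* J'
  e := J *ᵥ R.e
  generates n A := by
    have h1 := prod_map_conj h h' (List.ofFn fun i => R.F (A i))
    rw [List.map_ofFn] at h1
    change _ = (R.ρ ᵥ* J') ⬝ᵥ ((List.ofFn ((fun B => J * B * J') ∘ fun i => R.F (A i))).prod *ᵥ
      (J *ᵥ R.e))
    rw [R.generates, h1, Matrix.mulVec_mulVec, Matrix.mul_assoc, h, Matrix.mul_one,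
      ← Matrix.dotProduct_mulVec, Matrix.mulVec_mulVec, ← Matrix.mul_assoc, h, Matrix.one_mul]
  ρ_one := by
    change R.ρ ᵥ* J' ᵥ* (J * R.F 1 * J') = R.ρ ᵥ* J'
    rw [Matrix.vecMul_vecMul, ← Matrix.mul_assoc, ← Matrix.mul_assoc, h, Matrix.one_mul,
      ← Matrix.vecMul_vecMul, R.ρ_one]
  one_e := by
    change (J * R.F 1 * J') *ᵥ (J *ᵥ R.e) = J *ᵥ R.e
    rw [Matrix.mulVec_mulVec, Matrix.mul_assoc, Matrix.mul_assoc, h, Matrix.mul_one,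
      ← Matrix.mulVec_mulVec, R.one_e]

namespace MatrixRealization

variable (R : MatrixRealization ω m) {k : ℕ} (Z : HSBasis 𝒜 k)

theorem marginal_eq {n : ℕ} (X : chainAlg 𝒜 n) :
    ω.marginal n X = R.ρ ⬝ᵥ (evalWord (siteCoeff Z R.F) n X *ᵥ R.e) := by
  let g : chainAlg 𝒜 n →ₗ[ℂ] ℂ :=
    { toFun := fun X => R.ρ ⬝ᵥ (evalWord (siteCoeff Z R.F) n X *ᵥ R.e)
      map_add' := fun X X' => by
        simp [Matrix.add_mulVec]
      map_smul' := fun c X => by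
        simp [Matrix.smul_mulVec] }
  have h : ω.marginal n = g := chainAlg_linearMap_ext fun A => by
    rw [R.generates]
    change _ = R.ρ ⬝ᵥ (evalWord (siteCoeff Z R.F) n _ *ᵥ R.e)
    rw [evalWord_siteCoeff_elem]
  rw [h]
  rfl

theorem evalWord_one_mulVec (n : ℕ) : evalWord (siteCoeff Z R.F) n 1 *ᵥ R.e = R.e := by
  rw [evalWord_siteCoeff_one]
  induction n with
  | zero => simp
  | succ n ih => rw [pow_succ, ← Matrix.mulVec_mulVec, R.one_e, ih]

theorem vecMul_evalWord_one (n : ℕ) : R.ρ ᵥ* evalWord (siteCoeff Z R.F) n 1 = R.ρ := by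
  rw [evalWord_siteCoeff_one]
  induction n with
  | zero => simp
  | succ n ih => rw [pow_succ', ← Matrix.vecMul_vecMul, R.ρ_one, ih]

/-- The density matrix `Tᵀ = ∑ ω(z_κ) z_κ` of the extension belongs to the chain algebra, so
positivity of `ω` there already makes it positive semidefinite. A positive functional has norm its
value at `1`. -/
theorem fbdd_state (N : ℕ) : FBdd (Matrix.of fun f f' : Fin N → Fin d =>
    R.ρ ⬝ᵥ (kword (siteCoeff Z R.F) f f' *ᵥ R.e)) 1 := by
  let z : (Fin N → Fin k) → chainAlg 𝒜 N := fun κ =>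
    ⟨elem fun i => (Z.basis (κ i) : Matrix (Fin d) (Fin d) ℂ), elem_mem fun i => Z.basis (κ i)⟩
  set T : Matrix (Fin N → Fin d) (Fin N → Fin d) ℂ :=
    Matrix.of fun f f' => R.ρ ⬝ᵥ (kword (siteCoeff Z R.F) f f' *ᵥ R.e) with hT
  have hTS : Tᵀ ∈ chainAlg 𝒜 N := by
    have h : Tᵀ = ∑ κ, ω.marginal N (z κ) • (z κ : Matrix (Fin N → Fin d) (Fin N → Fin d) ℂ) := by
      ext g f
      rw [Matrix.transpose_apply, hT, Matrix.of_apply, kword_siteCoeff, Matrix.sum_mulVec,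
        dotProduct_sum, Matrix.sum_apply]
      refine Finset.sum_congr rfl fun κ _ => ?_
      rw [Matrix.smul_mulVec, dotProduct_smul, R.generates N fun i => Z.basis (κ i), smul_eq_mul,
        mul_comm]
      rfl
    rw [h]
    exact sum_mem fun κ _ => SMulMemClass.smul_mem _ (z κ).2
  have htr : ∀ X : chainAlg 𝒜 N,
      (Tᵀ * (X : Matrix (Fin N → Fin d) (Fin N → Fin d) ℂ)).trace = ω.marginal N X := by
    intro X
    rw [R.marginal_eq Z, dotProduct_evalWord_mulVec, Finset.sum_comm]
    refine Finset.sum_congr rfl fun g _ => Finset.sum_congr rfl fun f _ => mul_comm _ _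
  have hpos : Tᵀ.PosSemidef := posSemidef_of_trace_nonneg hTS fun Y hY => by
    have h := ω.nonneg N ⟨Y, hY⟩
    rwa [← htr] at h
  have h1 := FBdd.of_posSemidef hpos
  have h2 := htr 1
  rw [ω.map_one, OneMemClass.coe_one, mul_one] at h2
  rwa [h2, Matrix.transpose_transpose, Complex.one_re] at h1

end MatrixRealization

end Realizations

/-! ### Factorization of the Hankel matrices through the memory -/

section Factorization

variable {d m k l r p q : ℕ} {𝒜 : StarSubalgebra ℂ (Matrix (Fin d) (Fin d) ℂ)} {ω : ChainState 𝒜}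

theorem MatrixRealization.evalWord_conj (R : MatrixRealization ω m) (Z : HSBasis 𝒜 k)
    {J J' : Matrix (Fin m) (Fin m) ℂ} (h : J' * J = 1) (h' : J * J' = 1) {n : ℕ}
    (X : Matrix (Fin n → Fin d) (Fin n → Fin d) ℂ) :
    evalWord (siteCoeff Z (R.conj J J' h h').F) n X =
      J * evalWord (siteCoeff Z R.F) n X * J' := by
  rw [evalWord_siteCoeff, evalWord_siteCoeff, Matrix.mul_sum, Matrix.sum_mul]
  refine Finset.sum_congr rfl fun κ _ => ?_
  rw [Matrix.mul_smul, Matrix.smul_mul, ← prod_map_conj h h', List.map_ofFn]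
  rfl

/-- A chain has at least one degree of freedom per site. -/
theorem ChainState.site_dim_pos (ω : ChainState 𝒜) : 0 < d := by
  by_contra h0
  obtain rfl : d = 0 := by omega
  have h1 : (1 : chainAlg 𝒜 1) = 0 := by
    apply Subtype.ext
    ext f
    exact (f 0).elim0
  have h2 := ω.map_one 1
  rw [h1, map_zero] at h2
  exact zero_ne_one h2

/-- On zero sites the state gives `1`, while a zero-dimensional memory gives `0`. -/
theorem MatrixRealization.dim_pos (R : MatrixRealization ω m) : 0 < m := by
  by_contra h0
  obtain rfl : m = 0 := by omega
  have h1 := R.generates 0 fun _ => 1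
  have h2 := ω.map_one 0
  have h3 : (⟨elem fun _ : Fin 0 => ((1 : 𝒜) : Matrix (Fin d) (Fin d) ℂ),
      elem_mem fun _ => 1⟩ : chainAlg 𝒜 0) = 1 := Subtype.ext (elem_one 0)
  rw [h3, h2] at h1
  simp [dotProduct] at h1

theorem tens_eq_submatrix_kronecker {a b : ℕ} (Y : Matrix (Fin a → Fin d) (Fin a → Fin d) ℂ)
    (X : Matrix (Fin b → Fin d) (Fin b → Fin d) ℂ) :
    tens Y X = (Y ⊗ₖ X).submatrix (Fin.appendEquiv a b).symm (Fin.appendEquiv a b).symm := rfl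

theorem opNorm_tens_le {a b : ℕ} (Y : Matrix (Fin a → Fin d) (Fin a → Fin d) ℂ)
    (X : Matrix (Fin b → Fin d) (Fin b → Fin d) ℂ) : ‖tens Y X‖ ≤ frob Y * frob X := by
  rw [tens_eq_submatrix_kronecker]
  exact (opNorm_reindex_le _ _).trans ((opNorm_kronecker_le Y X).trans
    (mul_le_mul (opNorm_le_frob Y) (opNorm_le_frob X) (norm_nonneg _) (frob_nonneg _)))

variable {CL : StarSubalgebra ℂ (Matrix (Fin l → Fin d) (Fin l → Fin d) ℂ)}
  {CR : StarSubalgebra ℂ (Matrix (Fin r → Fin d) (Fin r → Fin d) ℂ)}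
  (hCL : CL ≤ chainAlg 𝒜 l) (hCR : CR ≤ chainAlg 𝒜 r)

namespace MatrixRealization

variable (R : MatrixRealization ω m) (Z : HSBasis 𝒜 k) (Y : HSBasis CL p) (X : HSBasis CR q)

/-- The matrix of `v ↦ (ρ 𝔼_{Y_i} v)_i`. -/
def leftMatrix : Matrix (Fin p) (Fin m) ℂ :=
  Matrix.of fun i => R.ρ ᵥ* evalWord (siteCoeff Z R.F) l (Y.basis i : CL)

/-- The matrix with columns `𝔼_{X_j} e`. -/
def rightMatrix : Matrix (Fin m) (Fin q) ℂ :=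
  (Matrix.of fun j => evalWord (siteCoeff Z R.F) r (X.basis j : CR) *ᵥ R.e)ᵀ

theorem vecMul_leftMatrix (u : Fin p → ℂ) : u ᵥ* R.leftMatrix Z Y =
    R.ρ ᵥ* evalWord (siteCoeff Z R.F) l
      (∑ i, u i • (Y.basis i : Matrix (Fin l → Fin d) (Fin l → Fin d) ℂ)) := by
  rw [map_sum, Matrix.vecMul_sum]
  funext x
  simp [leftMatrix, Matrix.vecMul, dotProduct, Finset.mul_sum, mul_left_comm]

theorem rightMatrix_mulVec (x : Fin q → ℂ) : R.rightMatrix Z X *ᵥ x =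
    evalWord (siteCoeff Z R.F) r
      (∑ j, x j • (X.basis j : Matrix (Fin r → Fin d) (Fin r → Fin d) ℂ)) *ᵥ R.e := by
  rw [map_sum, Matrix.sum_mulVec]
  funext y
  simp [rightMatrix, Matrix.mulVec, dotProduct, Finset.mul_sum, mul_comm, mul_left_comm]

theorem hankel_apply (x : CR) (y : CL) : hankel ω hCL hCR x y =
    (R.ρ ᵥ* evalWord (siteCoeff Z R.F) l y) ⬝ᵥ (evalWord (siteCoeff Z R.F) r x *ᵥ R.e) := by
  have h : hankel ω hCL hCR x y = ω.marginal (l + r) ⟨tens y.1 x.1, _⟩ := rfl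
  rw [h, R.marginal_eq Z, evalWord_tens, ← Matrix.mulVec_mulVec, Matrix.dotProduct_mulVec]

theorem hankelMatrix_eq :
    hankelMatrix ω hCL hCR Y X = R.leftMatrix Z Y * R.rightMatrix Z X := by
  ext i j
  exact R.hankel_apply hCL hCR Z (X.basis j) (Y.basis i)

theorem hankelSiteMatrix_eq (A : 𝒜) :
    hankelSiteMatrix ω hCL hCR Y X A = R.leftMatrix Z Y * R.F A * R.rightMatrix Z X := by
  ext i j
  rw [hankelSiteMatrix, Matrix.of_apply, hankelSite, R.marginal_eq Z, evalWord_tens, evalWord_tens,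
    evalWord_siteCoeff_site, ← Matrix.mulVec_mulVec, Matrix.dotProduct_mulVec,
    ← Matrix.vecMul_vecMul]
  rfl

theorem hankelOne_eq : hankelOne ω hCL hCR Y = R.leftMatrix Z Y *ᵥ R.e := by
  funext i
  rw [hankelOne, R.hankel_apply hCL hCR Z, OneMemClass.coe_one, R.evalWord_one_mulVec]
  rfl

theorem tauHankel_eq : tauHankel ω hCL hCR X = R.ρ ᵥ* R.rightMatrix Z X := by
  funext j
  rw [tauHankel, R.hankel_apply hCL hCR Z, OneMemClass.coe_one, R.vecMul_evalWord_one]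
  rfl

include R Z in
-- A matrix element of `Ω` is `ω` of a product of two observables whose Hilbert–Schmidt norms are
-- the Euclidean norms of their coordinates and dominate their operator norms. This is the source of
-- `σ_m(Ω) ≤ 1`.
theorem vnorm_hankelMatrix_mulVec_le (x : Fin q → ℂ) :
    vnorm (hankelMatrix ω hCL hCR Y X *ᵥ x) ≤ vnorm x := by
  refine vnorm_le_of_norm_dotProduct_le (vnorm_nonneg x) fun u => ?_
  rw [R.hankelMatrix_eq hCL hCR Z Y X, ← Matrix.mulVec_mulVec, Matrix.dotProduct_mulVec,
    R.vecMul_leftMatrix, R.rightMatrix_mulVec, ← Matrix.dotProduct_mulVec, Matrix.mulVec_mulVec,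
    ← evalWord_tens, dotProduct_evalWord_mulVec]
  refine (R.fbdd_state Z (l + r) _).trans ?_
  rw [one_mul]
  refine (opNorm_tens_le _ _).trans_eq ?_
  rw [Y.frob_sum_smul, X.frob_sum_smul, mul_comm]

theorem leftMatrix_conj {J J' : Matrix (Fin m) (Fin m) ℂ} (h : J' * J = 1) (h' : J * J' = 1) :
    (R.conj J J' h h').leftMatrix Z Y = R.leftMatrix Z Y * J' := by
  ext i x
  change ((R.ρ ᵥ* J') ᵥ* evalWord (siteCoeff Z (R.conj J J' h h').F) l (Y.basis i : CL)) x =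
    ((R.ρ ᵥ* evalWord (siteCoeff Z R.F) l (Y.basis i : CL)) ᵥ* J') x
  rw [R.evalWord_conj Z h h', Matrix.vecMul_vecMul, ← Matrix.mul_assoc, ← Matrix.mul_assoc, h,
    Matrix.one_mul, ← Matrix.vecMul_vecMul]

include R in
/-- After a change of basis, the coordinates `Uᴴ` on the functionals on the left half chain are the
coordinates of the realization. -/
theorem exists_normalized {U : Matrix (Fin p) (Fin m) ℂ} {a : ℝ} (ha : 0 < a)
    (h : ∀ v, a * vnorm v ≤ vnorm ((Uᴴ * hankelMatrix ω hCL hCR Y X)ᴴ *ᵥ v)) :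
    ∃ R' : MatrixRealization ω m, Uᴴ * R'.leftMatrix Z Y = 1 := by
  have h1 : (Uᴴ * R.leftMatrix Z Y) *
      (R.rightMatrix Z X * pinv (Uᴴ * hankelMatrix ω hCL hCR Y X)) = 1 := by
    rw [← Matrix.mul_assoc, Matrix.mul_assoc Uᴴ, ← R.hankelMatrix_eq hCL hCR]
    exact mul_pinv_eq_one ha h
  -- Both factors are square of size `m`, the minimal choice of memory here, so the right inverse is
  -- two-sided and `Uᴴ * L` can serve as the change of basis.
  have h2 := mul_eq_one_comm.mp h1
  exact ⟨R.conj _ _ h2 h1, by rw [R.leftMatrix_conj, ← Matrix.mul_assoc, h1]⟩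

/-- From `Uᴴ * L = 1`, `g = (g Uᴴ) L` exhibits `g` as `ρ 𝔼_Y` with `Y` of coordinates `g Uᴴ`.
Moreover `Uᴴ * Ω` is the matrix of the vectors `𝔼_{X_j} e`, and its lower bound lets every `v` be
reached. -/
theorem normingFrame {U : Matrix (Fin p) (Fin m) ℂ} (hU : Uᴴ * U = 1)
    (hUL : Uᴴ * R.leftMatrix Z Y = 1) {a : ℝ} (ha : 0 < a)
    (h : ∀ v, a * vnorm v ≤ vnorm ((Uᴴ * hankelMatrix ω hCL hCR Y X)ᴴ *ᵥ v)) :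
    NormingFrame (siteCoeff Z R.F) R.ρ R.e l r a where
  pos := ha
  state := R.fbdd_state Z
  left g := by
    refine ⟨∑ i, (g ᵥ* Uᴴ) i • (Y.basis i : Matrix (Fin l → Fin d) (Fin l → Fin d) ℂ), ?_, ?_⟩
    · have e : g ᵥ* Uᴴ = star (U *ᵥ star g) := by rw [Matrix.star_mulVec, star_star]
      rw [Y.frob_sum_smul, e, vnorm_star, vnorm_isometry_mulVec hU, vnorm_star]
    · intro N f f'
      have h1 : g = R.ρ ᵥ* evalWord (siteCoeff Z R.F) l
          (∑ i, (g ᵥ* Uᴴ) i • (Y.basis i : Matrix (Fin l → Fin d) (Fin l → Fin d) ℂ)) := by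
        rw [← R.vecMul_leftMatrix, Matrix.vecMul_vecMul, hUL, Matrix.vecMul_one]
      conv_lhs => rw [h1]
      rw [← Matrix.dotProduct_mulVec, dotProduct_evalWord_mulVec]
      simp only [kword_append, Matrix.mulVec_mulVec]
  right v := by
    obtain ⟨x, hx, hxn⟩ := exists_mulVec_eq_of_le_vnorm ha h v
    refine ⟨∑ j, x j • (X.basis j : Matrix (Fin r → Fin d) (Fin r → Fin d) ℂ), ?_, ?_⟩
    · rwa [X.frob_sum_smul]
    · rw [R.hankelMatrix_eq hCL hCR Z Y X, ← Matrix.mul_assoc, hUL, Matrix.one_mul,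
        R.rightMatrix_mulVec, evalWord_apply, Matrix.sum_mulVec] at hx
      rw [← hx]
      simp [Matrix.sum_mulVec, Matrix.smul_mulVec]

end MatrixRealization

/-- The `m`-th singular value of a Hankel matrix of rank `m` is positive. -/
theorem sigma_hankelMatrix_pos (Y : HSBasis CL p) (X : HSBasis CR q) (hm : 0 < m)
    (hrank : Module.finrank ℂ (LinearMap.range (hankel ω hCL hCR)) = m) :
    0 < sigma m (hankelMatrix ω hCL hCR Y X) := by
  rw [sigma, LinearMap.singularValues_pos_iff_lt_finrank_range]
  -- The coordinates of a functional on `CL` are its values on the basis `Y`, that is, coordinates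
  -- in the dual basis; so the matrix has the rank of `Ω`.
  have h1 : Matrix.toLin X.basis Y.basis.dualBasis (hankelMatrix ω hCL hCR Y X) =
      hankel ω hCL hCR := by
    refine X.basis.ext fun j => ?_
    refine Y.basis.ext fun i => ?_
    rw [Matrix.toLin_self]
    simp [hankelMatrix]
  have h2 := Matrix.rank_eq_finrank_range_toLin (hankelMatrix ω hCL hCR Y X) Y.basis.dualBasis
    X.basis
  have h3 := Matrix.rank_eq_finrank_range_toLin (hankelMatrix ω hCL hCR Y X)
    (EuclideanSpace.basisFun (Fin p) ℂ).toBasis (EuclideanSpace.basisFun (Fin q) ℂ).toBasis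
  rw [h1, hrank] at h2
  rw [← Matrix.toEuclideanLin_eq_toLin_orthonormal, h2] at h3
  omega

theorem sigma_hankelMatrix_le_one (R : MatrixRealization ω m) (Z : HSBasis 𝒜 k)
    (Y : HSBasis CL p) (X : HSBasis CR q)
    (hσ : 0 < sigma m (hankelMatrix ω hCL hCR Y X)) :
    sigma m (hankelMatrix ω hCL hCR Y X) ≤ 1 := by
  obtain ⟨V, hV, h⟩ := exists_isometry_sigma_le _ R.dim_pos hσ
  have hc : (Pi.single ⟨0, R.dim_pos⟩ 1 : Fin m → ℂ) ≠ 0 := by simp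
  refine le_of_mul_le_mul_right ?_ (vnorm_pos hc)
  rw [one_mul]
  refine (h _).trans ((R.vnorm_hankelMatrix_mulVec_le hCL hCR Z Y X _).trans_eq ?_)
  exact vnorm_isometry_mulVec hV _

end Factorization

/-! ### The reconstruction error -/

namespace LocalEstimates

variable {d p q m k : ℕ} {𝒜 : StarSubalgebra ℂ (Matrix (Fin d) (Fin d) ℂ)}
  (est : LocalEstimates 𝒜 p q) (U : Matrix (Fin p) (Fin m) ℂ)

/-- `A ↦ K̂_A` as a linear map. -/
def KHatLin : 𝒜 →ₗ[ℂ] Matrix (Fin m) (Fin m) ℂ where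
  toFun := est.KHat U
  map_add' B C := by simp [KHat, Matrix.mul_add, Matrix.add_mul]
  map_smul' c B := by simp [KHat]

theorem reconstruction_eq (Z : HSBasis 𝒜 k) (t : ℕ) (X : chainAlg 𝒜 t) :
    est.reconstruction U Z t X =
      est.rhoHat U ⬝ᵥ (evalWord (siteCoeff Z (est.KHatLin U)) t X *ᵥ est.eHat U) := by
  rw [evalWord_siteCoeff, Matrix.sum_mulVec, dotProduct_sum]
  refine Finset.sum_congr rfl fun κ _ => ?_
  rw [Matrix.smul_mulVec, dotProduct_smul]
  rfl

end LocalEstimates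

theorem traceNorm_le {d n : ℕ} {𝒜 : StarSubalgebra ℂ (Matrix (Fin d) (Fin d) ℂ)}
    {φ : chainAlg 𝒜 n →ₗ[ℂ] ℂ} {T : Matrix (Fin n → Fin d) (Fin n → Fin d) ℂ} {c : ℝ}
    (hc : 0 ≤ c) (hφ : ∀ X : chainAlg 𝒜 n, φ X = pairing T X) (hT : FBdd T c) :
    traceNorm φ ≤ c := by
  refine csSup_le ⟨_, 0, by simp, rfl⟩ ?_
  rintro _ ⟨X, hX, rfl⟩
  rw [hφ]
  exact (hT _).trans (mul_le_of_le_one_right hc hX)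

/-- `(1 + ε / t) ^ t ≤ exp ε ≤ 1 + ε + ε² ≤ 1 + 2 ε`; the remaining cubic is made linear by `ε², ε³
≤ ε`, and `145 / 9` leaves room. -/
theorem one_add_mul_pow_bound {ε : ℝ} (h0 : 0 ≤ ε) (h1 : ε ≤ 1) {t : ℕ} (ht : 0 < t) :
    (1 + ε) * (1 + ε / t) ^ t * (1 + 21 / 20 * ε) - 1 ≤ 145 / 9 * ε := by
  have ht' : (0 : ℝ) < t := by exact_mod_cast ht
  have h2 : (1 + ε / t) ^ t ≤ 1 + 2 * ε := by
    have h3 : (1 + ε / t) ^ t ≤ Real.exp ε := by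
      calc (1 + ε / t) ^ t ≤ Real.exp (ε / t) ^ t := by
            refine pow_le_pow_left₀ (by positivity) ?_ t
            linarith [Real.add_one_le_exp (ε / t)]
        _ = Real.exp ε := by rw [← Real.exp_nat_mul]; congr 1; field_simp
    have h4 := Real.abs_exp_sub_one_sub_id_le (x := ε) (by rw [abs_of_nonneg h0]; exact h1)
    have h5 := (abs_le.mp h4).2
    nlinarith
  have h6 : (1 + ε) * (1 + ε / t) ^ t * (1 + 21 / 20 * ε) ≤
      (1 + ε) * (1 + 2 * ε) * (1 + 21 / 20 * ε) := by gcongr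
  have h7 : ε ^ 2 ≤ ε := by nlinarith
  have h8 : ε ^ 3 ≤ ε := by nlinarith
  nlinarith

theorem sqrt_three_le : √(3 : ℝ) ≤ 7 / 4 := by
  rw [Real.sqrt_le_left (by norm_num)]
  norm_num

section Reconstruction

variable {d : ℕ} {𝒜 : StarSubalgebra ℂ (Matrix (Fin d) (Fin d) ℂ)} {ω : ChainState 𝒜} {m l r : ℕ}
  {CL : StarSubalgebra ℂ (Matrix (Fin l → Fin d) (Fin l → Fin d) ℂ)} (hCL : CL ≤ chainAlg 𝒜 l)
  {CR : StarSubalgebra ℂ (Matrix (Fin r → Fin d) (Fin r → Fin d) ℂ)} (hCR : CR ≤ chainAlg 𝒜 r)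
  {k p q : ℕ} (Z : HSBasis 𝒜 k) (Y : HSBasis CL p) (X : HSBasis CR q)
  (est : LocalEstimates 𝒜 p q) {U : Matrix (Fin p) (Fin m) ℂ}

/-- Reconstruction error in terms of lower bounds on the compressed Hankel matrices. -/
theorem fbdd_reconstruction_error (R : MatrixRealization ω m) (hU : Uᴴ * U = 1)
    (hUL : Uᴴ * R.leftMatrix Z Y = 1) {a b : ℝ} (ha : 0 < a) (hb : 0 < b)
    (h : ∀ v, a * vnorm v ≤ vnorm ((Uᴴ * hankelMatrix ω hCL hCR Y X)ᴴ *ᵥ v))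
    (h' : ∀ v, b * vnorm v ≤ vnorm ((Uᴴ * est.Omega)ᴴ *ᵥ v)) {α β γ : ℝ}
    (hα : 1 / a * (√(m : ℝ) * (hsNorm (hankelMatrix ω hCL hCR Y X - est.Omega) / b)) +
      euclNorm (tauHankel ω hCL hCR X - est.tauOmega) / b ≤ α)
    (hβ : 1 / a * (√(m : ℝ) * (hsNorm (hankelMatrix ω hCL hCR Y X - est.Omega) / b)) +
      1 / a * (√(m : ℝ) * (√(d : ℝ) *
        (hsNormSite Z (fun A => hankelSiteMatrix ω hCL hCR Y X A - est.OmegaSite A) / b))) ≤ β)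
    (hγ : euclNorm (hankelOne ω hCL hCR Y - est.OmegaOne) / a ≤ γ) (t : ℕ) :
    FBdd (Matrix.of fun f f' : Fin t → Fin d =>
        est.rhoHat U ⬝ᵥ (kword (siteCoeff Z (est.KHatLin U)) f f' *ᵥ est.eHat U) -
          R.ρ ⬝ᵥ (kword (siteCoeff Z R.F) f f' *ᵥ R.e))
      ((1 + α) * (1 + β) ^ t * (1 + γ) - 1) := by
  set Ω := hankelMatrix ω hCL hCR Y X with hΩ
  set P := pinv (Uᴴ * est.Omega) with hP
  set M := R.rightMatrix Z X with hM
  have hUΩ : Uᴴ * Ω = M := by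
    rw [hΩ, R.hankelMatrix_eq hCL hCR Z Y X, ← Matrix.mul_assoc, hUL, Matrix.one_mul]
  have hMP : Uᴴ * est.Omega * P = 1 := mul_pinv_eq_one hb h'
  set Θ := Uᴴ * (Ω - est.Omega) * P with hΘ
  -- `P` inverts `Uᴴ Ω̂` on the right exactly, so `Θ` measures how far it is from inverting `Uᴴ Ω =
  -- M`.
  have hΘ' : M * P = 1 + Θ := by
    rw [hΘ, Matrix.mul_sub, Matrix.sub_mul, hUΩ, hMP]
    abel
  -- `Uᴴ Ω_A P = 𝔼_A M P = 𝔼_A (1 + Θ)`, so what remains of `K̂_A` is due only to the error in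
  -- `Ω_A`.
  let Δ : 𝒜 →ₗ[ℂ] Matrix (Fin m) (Fin m) ℂ :=
    { toFun := fun A => est.KHatLin U A - R.F A - R.F A * Θ
      map_add' := fun A B => by simp only [map_add, Matrix.add_mul]; abel
      map_smul' := fun c A => by simp [smul_sub] }
  have hΔ : ∀ A, Δ A = -(Uᴴ * (hankelSiteMatrix ω hCL hCR Y X A - est.OmegaSite A)) * P := by
    intro A
    have h1 : Uᴴ * hankelSiteMatrix ω hCL hCR Y X A = R.F A * M := by
      rw [R.hankelSiteMatrix_eq hCL hCR Z Y X, ← Matrix.mul_assoc, ← Matrix.mul_assoc, hUL,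
        Matrix.one_mul]
    have h2 : R.F A * M * P = R.F A + R.F A * Θ := by
      rw [Matrix.mul_assoc, hΘ', Matrix.mul_add, Matrix.mul_one]
    change Uᴴ * est.OmegaSite A * P - R.F A - R.F A * Θ = _
    rw [Matrix.mul_sub, h1, neg_sub, Matrix.sub_mul, h2]
    abel
  have hfrobΘ : frob Θ ≤ hsNorm (Ω - est.Omega) / b := by
    rw [hsNorm_eq_frob]
    exact (frob_mul_pinv_le hb h' _).trans
      (div_le_div_of_nonneg_right (frob_conjTranspose_isometry_mul_le hU _) hb.le)
  have hfrobΔ : √(∑ i, ∑ j, frob (siteCoeff Z Δ i j) ^ 2) ≤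
      hsNormSite Z (fun A => hankelSiteMatrix ω hCL hCR Y X A - est.OmegaSite A) / b := by
    rw [sum_frob_siteCoeff, hsNormSite, Real.sqrt_le_left (by positivity), div_pow,
      Real.sq_sqrt (Finset.sum_nonneg fun _ _ => sq_nonneg _), Finset.sum_div]
    refine Finset.sum_le_sum fun j _ => ?_
    rw [← div_pow, hsNorm_eq_frob]
    refine pow_le_pow_left₀ (frob_nonneg _) ?_ 2
    rw [hΔ, ← Matrix.mul_neg, neg_sub]
    refine (frob_mul_pinv_le hb h' _).trans (div_le_div_of_nonneg_right ?_ hb.le)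
    refine (frob_conjTranspose_isometry_mul_le hU _).trans_eq ?_
    rw [frob_eq_sqrt, frob_eq_sqrt]
    simp only [Matrix.sub_apply, norm_sub_rev]
  have F := R.normingFrame hCL hCR Z Y X hU hUL ha h
  refine F.fbdd_perturbation (Θ := Θ) (Δ := siteCoeff Z Δ)
    (η := (est.tauOmega - tauHankel ω hCL hCR X) ᵥ* P)
    (ζ := Uᴴ *ᵥ (est.OmegaOne - hankelOne ω hCL hCR Y)) ?_ ?_ ?_ ?_ ?_ ?_ t
  · intro i j
    simp only [siteCoeff, Finset.sum_mul, ← Finset.sum_add_distrib]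
    refine Finset.sum_congr rfl fun x _ => ?_
    rw [Matrix.smul_mul, ← smul_add, ← smul_add]
    congr 1
    change _ = _ + (est.KHatLin U _ - R.F _ - R.F _ * Θ)
    abel
  · have h1 : tauHankel ω hCL hCR X ᵥ* P = R.ρ + R.ρ ᵥ* Θ := by
      rw [R.tauHankel_eq hCL hCR Z X, Matrix.vecMul_vecMul, hΘ', Matrix.vecMul_add,
        Matrix.vecMul_one]
    rw [Matrix.sub_vecMul, h1]
    change est.tauOmega ᵥ* P = _
    abel
  · have h1 : Uᴴ *ᵥ hankelOne ω hCL hCR Y = R.e := by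
      rw [R.hankelOne_eq hCL hCR Z Y, Matrix.mulVec_mulVec, hUL, Matrix.one_mulVec]
    rw [Matrix.mulVec_sub, h1]
    change Uᴴ *ᵥ est.OmegaOne = _
    abel
  · refine le_trans (add_le_add ?_ ?_) hα
    · gcongr
    · refine (vnorm_vecMul_pinv_le hb h' _).trans_eq ?_
      rw [euclNorm_eq_vnorm, vnorm_eq_sqrt, vnorm_eq_sqrt]
      simp only [Pi.sub_apply, norm_sub_rev]
  · refine le_trans (add_le_add ?_ ?_) hβ
    · gcongr
    · gcongr
  · refine le_trans (div_le_div_of_nonneg_right ?_ ha.le) hγ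
    refine (vnorm_conjTranspose_isometry_mulVec_le hU _).trans_eq ?_
    rw [euclNorm_eq_vnorm, vnorm_eq_sqrt, vnorm_eq_sqrt]
    simp only [Pi.sub_apply, norm_sub_rev]

/-- The reconstruction error under the error thresholds with an effective memory size `D`. -/
theorem traceNorm_reconstruction_le (R : MatrixRealization ω m)
    (hrank : Module.finrank ℂ (LinearMap.range (hankel ω hCL hCR)) = m)
    (hU : IsTruncatedLeftSVD est.Omega U) {t : ℕ} (ht : 0 < t) {ε : ℝ} (hε : ε < 1)
    {σ : ℝ} (hσ : σ = sigma m (hankelMatrix ω hCL hCR Y X)) {D : ℝ} (hD : √(m : ℝ) ≤ D)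
    (h1 : euclNorm (tauHankel ω hCL hCR X - est.tauOmega) ≤ 3 * σ / 4 * ε)
    (h2 : euclNorm (hankelOne ω hCL hCR Y - est.OmegaOne) ≤ √3 * σ / 2 * ε)
    (h3 : hsNorm (hankelMatrix ω hCL hCR Y X - est.Omega) ≤
      1 / 3 * min (σ ^ 2 / 4 * ε) (√3 * σ ^ 3 / (8 * t * D * √(d : ℝ)) * ε))
    (h4 : hsNormSite Z (fun A => hankelSiteMatrix ω hCL hCR Y X A - est.OmegaSite A) ≤
      3 * √3 * σ ^ 2 / (8 * t * D * √(d : ℝ)) * ε) :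
    traceNorm (est.reconstruction U Z t - ω.marginal t) ≤ 145 / 9 * ε := by
  have hm := R.dim_pos
  have hσ0 : 0 < σ := hσ ▸ sigma_hankelMatrix_pos hCL hCR Y X hm hrank
  have hσ1 : σ ≤ 1 := hσ ▸ sigma_hankelMatrix_le_one hCL hCR R Z Y X (hσ ▸ hσ0)
  have hε0 : 0 ≤ ε := by
    have h5 : 0 ≤ 3 * σ / 4 * ε := (Real.sqrt_nonneg _).trans h1
    exact nonneg_of_mul_nonneg_right h5 (by positivity)
  have ht1 : (1 : ℝ) ≤ t := by exact_mod_cast ht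
  have hd1 : 1 ≤ √(d : ℝ) := Real.one_le_sqrt.mpr (by exact_mod_cast ω.site_dim_pos)
  have hm1 : 1 ≤ √(m : ℝ) := Real.one_le_sqrt.mpr (by exact_mod_cast hm)
  have hD1 : 1 ≤ D := hm1.trans hD
  set δ := hsNorm (hankelMatrix ω hCL hCR Y X - est.Omega) with hδ
  set δ' := hsNormSite Z (fun A => hankelSiteMatrix ω hCL hCR Y X A - est.OmegaSite A) with hδ'
  have hδ0 : 0 ≤ δ := Real.sqrt_nonneg _
  have hδ'0 : 0 ≤ δ' := Real.sqrt_nonneg _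
  -- Here `σ ≤ 1` and `ε < 1` reduce `σ² ε / 12` to `σ / 12`. One such loss turns `σ` into the bound
  -- `b = 11/12 σ` for `Uᴴ Ω̂`, a second into `a = 5/6 σ` for `Uᴴ Ω`.
  have hδ1 : δ ≤ σ / 12 := by
    have h5 : δ ≤ 1 / 3 * (σ ^ 2 / 4 * ε) :=
      h3.trans (mul_le_mul_of_nonneg_left (min_le_left _ _) (by norm_num))
    have h6 : σ ^ 2 * ε ≤ σ * 1 := by
      refine mul_le_mul ?_ hε.le hε0 hσ0.le
      nlinarith
    linarith
  have hs3 := sqrt_three_le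
  have hδ2 : D * (√(d : ℝ) * (t * δ)) ≤ 7 / 96 * (σ ^ 2 * ε) := by
    have h5 : δ ≤ 1 / 3 * (√3 * σ ^ 3 / (8 * t * D * √(d : ℝ)) * ε) :=
      h3.trans (mul_le_mul_of_nonneg_left (min_le_right _ _) (by norm_num))
    have h6 : D * (√(d : ℝ) * (t * δ)) ≤ √3 * σ ^ 3 / 24 * ε := by
      calc _ ≤ D * (√(d : ℝ) * (t * (1 / 3 * (√3 * σ ^ 3 / (8 * t * D * √(d : ℝ)) * ε)))) := by
            gcongr
        _ = _ := by field_simp; ring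
    have h7 : √3 * (σ ^ 3 * ε) ≤ 7 / 4 * (σ ^ 2 * ε) :=
      mul_le_mul hs3 (mul_le_mul_of_nonneg_right
        (pow_le_pow_of_le_one hσ0.le hσ1 (by norm_num : 2 ≤ 3)) hε0) (by positivity) (by norm_num)
    linarith
  have hδ'2 : D * (√(d : ℝ) * (t * δ')) ≤ 21 / 32 * (σ ^ 2 * ε) := by
    have h6 : D * (√(d : ℝ) * (t * δ')) ≤ 3 * √3 * σ ^ 2 / 8 * ε := by
      calc _ ≤ D * (√(d : ℝ) * (t * (3 * √3 * σ ^ 2 / (8 * t * D * √(d : ℝ)) * ε))) := by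
            gcongr
        _ = _ := by field_simp
    have h7 : √3 * (σ ^ 2 * ε) ≤ 7 / 4 * (σ ^ 2 * ε) := by gcongr
    linarith
  have hb : ∀ v, 11 / 12 * σ * vnorm v ≤ vnorm ((Uᴴ * est.Omega)ᴴ *ᵥ v) := by
    intro v
    have h5 := hU.le_vnorm hm (hσ ▸ hσ0) v
    rw [← hσ, ← hsNorm_eq_frob, ← hδ] at h5
    refine le_trans (mul_le_mul_of_nonneg_right ?_ (vnorm_nonneg v)) h5
    linarith
  have ha : ∀ v, 5 / 6 * σ * vnorm v ≤
      vnorm ((Uᴴ * hankelMatrix ω hCL hCR Y X)ᴴ *ᵥ v) := by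
    intro v
    have h5 := vnorm_sub_le ((Uᴴ * est.Omega)ᴴ *ᵥ v) ((Uᴴ * hankelMatrix ω hCL hCR Y X)ᴴ *ᵥ v)
    rw [← Matrix.sub_mulVec, ← Matrix.conjTranspose_sub, ← Matrix.mul_sub] at h5
    have h6 : vnorm ((Uᴴ * (est.Omega - hankelMatrix ω hCL hCR Y X))ᴴ *ᵥ v) ≤ δ * vnorm v := by
      refine (vnorm_mulVec_le_frob _ _).trans (mul_le_mul_of_nonneg_right ?_ (vnorm_nonneg v))
      rw [frob_conjTranspose]
      refine (frob_conjTranspose_isometry_mul_le hU.isometry _).trans_eq ?_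
      rw [hδ, hsNorm_eq_frob, frob_eq_sqrt, frob_eq_sqrt]
      simp only [Matrix.sub_apply, norm_sub_rev]
    have h7 := hb v
    have h8 := mul_le_mul_of_nonneg_right hδ1 (vnorm_nonneg v)
    linarith
  obtain ⟨R', hR'⟩ := R.exists_normalized hCL hCR Z Y X (by positivity) ha
  -- `72 / 55` is the inverse of `5/6 * 11/12`. The budget `ε / t` per site is split into a tenth
  -- for `Θ` and nine tenths for `Δ`.
  have hΘ : 1 / (5 / 6 * σ) * (√(m : ℝ) * (δ / (11 / 12 * σ))) ≤ 1 / 10 * (ε / t) := by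
    have h5 : √(m : ℝ) * (t * δ) ≤ 7 / 96 * (σ ^ 2 * ε) := by
      refine le_trans ?_ hδ2
      refine mul_le_mul hD ?_ (by positivity) (by positivity)
      exact le_mul_of_one_le_left (by positivity) hd1
    calc _ = (72 / 55 / (t * σ ^ 2)) * (√(m : ℝ) * (t * δ)) := by field_simp; ring
      _ ≤ (72 / 55 / (t * σ ^ 2)) * (7 / 96 * (σ ^ 2 * ε)) := by gcongr
      _ = 504 / 5280 * (ε / t) := by field_simp; ring
      _ ≤ _ := mul_le_mul_of_nonneg_right (by norm_num) (by positivity)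
  have hΔ : 1 / (5 / 6 * σ) * (√(m : ℝ) * (√(d : ℝ) * (δ' / (11 / 12 * σ)))) ≤
      9 / 10 * (ε / t) := by
    have h5 : √(m : ℝ) * (√(d : ℝ) * (t * δ')) ≤ 21 / 32 * (σ ^ 2 * ε) :=
      le_trans (mul_le_mul_of_nonneg_right hD (by positivity)) hδ'2
    calc _ = (72 / 55 / (t * σ ^ 2)) * (√(m : ℝ) * (√(d : ℝ) * (t * δ'))) := by
          field_simp; ring
      _ ≤ (72 / 55 / (t * σ ^ 2)) * (21 / 32 * (σ ^ 2 * ε)) := by gcongr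
      _ = 1512 / 1760 * (ε / t) := by field_simp; ring
      _ ≤ _ := mul_le_mul_of_nonneg_right (by norm_num) (by positivity)
  -- `α = ε` covers `1/10 + 9/11`, where `9/11 = (3/4) / (11/12)`; `γ` uses `21/20 = (7/8) / (5/6)`,
  -- with `√3 / 2 ≤ 7/8`.
  have hF := fbdd_reconstruction_error hCL hCR Z Y X est R' hU.isometry hR'
    (α := ε) (β := ε / t) (γ := 21 / 20 * ε) (by positivity) (by positivity) ha hb
    (by
      have h5 : ε / t ≤ ε := div_le_self hε0 ht1
      have h6 : euclNorm (tauHankel ω hCL hCR X - est.tauOmega) / (11 / 12 * σ) ≤ 9 / 11 * ε := by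
        rw [div_le_iff₀ (by positivity)]
        linarith
      linarith)
    (by linarith)
    (by
      rw [div_le_iff₀ (by positivity)]
      refine h2.trans ?_
      have h5 : √3 * (σ * ε) ≤ 7 / 4 * (σ * ε) := by gcongr
      linarith)
    t
  refine traceNorm_le (by positivity) (fun W => ?_) (hF.mono (one_add_mul_pow_bound hε0 hε.le ht))
  rw [LinearMap.sub_apply, est.reconstruction_eq, R'.marginal_eq Z, dotProduct_evalWord_mulVec,
    dotProduct_evalWord_mulVec, pairing]
  simp only [Matrix.of_apply, mul_sub, Finset.sum_sub_distrib]

end Reconstruction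

/-- Transport of a realization along a linear equivalence of the memory spaces. -/
def Realization.congr {d : ℕ} {𝒜 : StarSubalgebra ℂ (Matrix (Fin d) (Fin d) ℂ)}
    {ω : ChainState 𝒜} {V W : Type*} [AddCommGroup V] [Module ℂ V] [AddCommGroup W] [Module ℂ W]
    (R : Realization ω V) (u : V ≃ₗ[ℂ] W) : Realization ω W where
  e := u R.e
  E := (u.conjAlgEquiv ℂ).toLinearMap ∘ₗ R.E
  ρ := R.ρ ∘ₗ u.symm.toLinearMap
  generates n A := by
    have h : (List.ofFn fun i => ((u.conjAlgEquiv ℂ).toLinearMap ∘ₗ R.E) (A i)).prod =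
        u.conjAlgEquiv ℂ (List.ofFn fun i => R.E (A i)).prod := by
      rw [map_list_prod, List.map_ofFn]
      rfl
    rw [R.generates, h]
    simp [LinearEquiv.conjAlgEquiv_apply]
  ρ_E_one := by
    ext w
    simpa [LinearEquiv.conjAlgEquiv_apply] using LinearMap.congr_fun R.ρ_E_one (u.symm w)
  E_one_e := by
    simp [LinearEquiv.conjAlgEquiv_apply, R.E_one_e]

/-- In a basis of `ℬ` the realization competes for the minimal dimension, and `dim ℬ ≤ dB²`. Hence
`√m ≤ dB`. -/
theorem IsMinimalDim.le_sq {d : ℕ} {𝒜 : StarSubalgebra ℂ (Matrix (Fin d) (Fin d) ℂ)}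
    {ω : ChainState 𝒜} {m : ℕ} (hm : IsMinimalDim ω m) {dB : ℕ}
    {ℬ : StarSubalgebra ℂ (Matrix (Fin dB) (Fin dB) ℂ)} (R : Realization ω ℬ) : m ≤ dB ^ 2 := by
  have : Module.Finite ℂ ℬ :=
    inferInstanceAs (Module.Finite ℂ ℬ.toSubalgebra.toSubmodule)
  have h1 : m ≤ Module.finrank ℂ ℬ :=
    hm.2 ⟨R.congr (Module.finBasis ℂ ℬ).equivFun⟩
  have h2 := Submodule.finrank_le ℬ.toSubalgebra.toSubmodule
  rw [Module.finrank_matrix] at h2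
  refine h1.trans (h2.trans_eq ?_)
  simp [sq]

end FCS

end

open FCS in
theorem mainTheorem4 {d : ℕ} (𝒜 : StarSubalgebra ℂ (Matrix (Fin d) (Fin d) ℂ))
    (ω : ChainState 𝒜) (m : ℕ) (hm : IsMinimalDim ω m)
    {l r : ℕ}
    (CL : StarSubalgebra ℂ (Matrix (Fin l → Fin d) (Fin l → Fin d) ℂ)) (hCL : CL ≤ chainAlg 𝒜 l)
    (CR : StarSubalgebra ℂ (Matrix (Fin r → Fin d) (Fin r → Fin d) ℂ)) (hCR : CR ≤ chainAlg 𝒜 r)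
    (hrank : Module.finrank ℂ (LinearMap.range (hankel ω hCL hCR)) = m)
    {k p q : ℕ} (Z : HSBasis 𝒜 k) (Y : HSBasis CL p) (X : HSBasis CR q)
    (est : LocalEstimates 𝒜 p q)
    (U : Matrix (Fin p) (Fin m) ℂ) (hU : IsTruncatedLeftSVD est.Omega U)
    (t : ℕ) (ht : 0 < t) (ε : ℝ) (hε : ε < 1)
    (σ : ℝ) (hσ : σ = sigma m (hankelMatrix ω hCL hCR Y X)) :
    (euclNorm (tauHankel ω hCL hCR X - est.tauOmega) ≤ 3 * σ / 4 * ε →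
      euclNorm (hankelOne ω hCL hCR Y - est.OmegaOne) ≤ √3 * σ / 2 * ε →
      hsNorm (hankelMatrix ω hCL hCR Y X - est.Omega) ≤
        1 / 3 * min (σ ^ 2 / 4 * ε) (√3 * σ ^ 3 / (8 * t * m * √(d : ℝ)) * ε) →
      hsNormSite Z (fun A => hankelSiteMatrix ω hCL hCR Y X A - est.OmegaSite A) ≤
        3 * √3 * σ ^ 2 / (8 * t * m * √(d : ℝ)) * ε →
      traceNorm (est.reconstruction U Z t - ω.marginal t) ≤ 145 / 9 * ε) ∧
    (∀ (dB : ℕ) (ℬ : StarSubalgebra ℂ (Matrix (Fin dB) (Fin dB) ℂ)) (R : Realization ω ℬ),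
      IsCStarRealization R →
      euclNorm (tauHankel ω hCL hCR X - est.tauOmega) ≤ 3 * σ / 4 * ε →
      euclNorm (hankelOne ω hCL hCR Y - est.OmegaOne) ≤ √3 * σ / (2 * √(dB : ℝ)) * ε →
      hsNorm (hankelMatrix ω hCL hCR Y X - est.Omega) ≤
        1 / 3 * min (σ ^ 2 / 4 * ε) (√3 * σ ^ 3 / (8 * t * dB * √(d : ℝ)) * ε) →
      hsNormSite Z (fun A => hankelSiteMatrix ω hCL hCR Y X A - est.OmegaSite A) ≤
        3 * √3 * σ ^ 2 / (8 * t * dB * √(d : ℝ)) * ε →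
      traceNorm (est.reconstruction U Z t - ω.marginal t) ≤ 145 / 9 * ε) := by
  obtain ⟨R₀⟩ := hm.1
  let R := R₀.toMatrixRealization
  have hm0 := R.dim_pos
  have hm1 : (1 : ℝ) ≤ m := by exact_mod_cast hm0
  refine ⟨fun h1 h2 h3 h4 => ?_, fun dB ℬ S _ h1 h2 h3 h4 => ?_⟩
  -- `D = m`, using `√m ≤ m` for `m ≥ 1`.
  · refine traceNorm_reconstruction_le hCL hCR Z Y X est R hrank hU ht hε hσ ?_ h1 h2 h3 h4
    rw [Real.sqrt_le_left (by positivity)]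
    nlinarith
  · have hdB := hm.le_sq S
    have hdB0 : 0 < dB := by
      rcases Nat.eq_zero_or_pos dB with rfl | h
      · omega
      · exact h
    -- `D = dB`. The threshold on `Ω(1)` carries an extra `1 / √dB ≤ 1`, so it implies the one
    -- without it.
    refine traceNorm_reconstruction_le hCL hCR Z Y X est R hrank hU ht hε hσ ?_ h1 (h2.trans ?_)
      h3 h4
    · rw [Real.sqrt_le_left (by positivity)]
      exact_mod_cast hdB
    · have hσ0 : 0 < σ := hσ ▸ sigma_hankelMatrix_pos hCL hCR Y X hm0 hrank
      have hε0 : 0 ≤ ε := by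
        have h5 : 0 ≤ 3 * σ / 4 * ε := (Real.sqrt_nonneg _).trans h1
        exact nonneg_of_mul_nonneg_right h5 (by positivity)
      have hd1 : 1 ≤ √(dB : ℝ) := Real.one_le_sqrt.mpr (by exact_mod_cast hdB0)
      gcongr
      linarith
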